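/- Let $(I,\mathcal T)$ be a countably infinite, locally finite tree with root $r$ such that every branch $[i,\infty)=\{j\in I: i\preceq j\}$ is infinite, where $i\preceq j$ means that $i$ lies on the geodesic from $r$ to $j$. Let $|i|$ be the distance from $r$ to $i$ and, for $i\neq r$, let $i^-$ be the predecessor of $i$. Let $\partial_\infty$ be the boundary of the tree; for $\xi\in\partial_\infty$ let $(\xi(n))_{n\ge 0}$ be the geodesic from $r$ to $\xi$, let $C^n(\xi)=\{\eta\in\partial_\infty:\eta(n)=\xi(n)\}$, and let $\mathcal F_n$ be the $\sigma$-field on $\partial_\infty$ generated by the sets $C^n(\xi)$. For $i\in I$ and distinct $\eta,\xi\in\partial_\infty$ let $|i\wedge\eta|=\max\{n:\eta(n)\preceq i\}$ and $|\eta\wedge\xi|=\max\{n:\eta(n)=\xi(n)\}$. Let $(w_n)_{n\ge 0}$ be strictly positive and strictly increasing, $\Delta_0(w)=w_0$ and $\Delta_n(w)=w_n-w_{n-1}$ for $n\ge1$. Put $U_{i\eta}=w_{|i\wedge\eta|}$, $U_{\eta\xi}=w_{|\eta\wedge\xi|}$ for $\eta\ne\xi$, and $U_{\eta\eta}=\lim_n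 w_n\in(0,\infty]$. Let $Q$ be the symmetric conservative $q$-matrix on $I$ supported by the tree and the diagonal, with $Q_{ii^-}=Q_{i^-i}=\Delta_{|i|}(w)^{-1}$ for $i\neq r$ (reflection at the root). Let $X$ be the minimal Markov process with generator $Q$, $\zeta$ its lifetime, $P_t$ its semigroup, $V=\int_0^\infty P_t\,dt$ its potential and $X_\zeta$ its limit in $\partial_\infty$ at time $\zeta$, when it exists. For $a\ge 0$ let $X^{(a)}$ be the minimal Markov process on $I\cup\{\partial_r\}$ with the same rates between sites and the additional rate $1/(w_0+a)$ from $r$ to the absorbing state $\partial_r$. Assume that $X$ is transient, i.e. $\mathbb P_r\{X_\zeta\in\partial_\infty\}=1$, and that all points $\eta\in\partial_\infty$ are regular, i.e. $\mathbb P_j\{X^{(0)}\text{ hits }\partial_r\}\to 0$ as $j\to\eta$, $j\in I$. Let $\mu=\mathbb P_r\{X_\zeta\in\cdot\}$, let $\mu^{(a)}=\mathbb P_r\{X^{(a)}_\zeta\in\cdot\mid X^{(a)}_\zeta\in\partial_\infty\}$, and for $k\ge 1$ let $G^{(a)}_k(\eta)=\sum_{n\ge k}\Delta_n(w)\,\mu^{(a)}(C^n(\eta))$.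 Then $0<V_{ij}<\infty$ for all $i,j\in I$. Put $G_0(\eta)=\int U_{\eta\xi}\,\mu(d\xi)$. The limits $G_k(\eta)=\lim_{a\to\infty}G^{(a)}_k(\eta)$, $k\ge1$, exist and are finite, and: 1. $G_0(\eta)=V_{rr}+w_0$ for every $\eta\in\partial_\infty$; in particular $G_0$ is constant. 2. The process $(G_k)_{k\ge 0}$ is positive, (strictly) decreasing in $k$ and predictable ($G_0$ is constant and $G_k$ is $\mathcal F_{k-1}$-measurable for $k\ge 1$), and for all $k\ge 1$ and $\eta\in\partial_\infty$ $$G_k(\eta)=G_0-\sum_{n=0}^{k-1}\Delta_n(w)\,\mu(C^n(\eta))=\sum_{n\ge k}\Delta_n(w)\,\mu(C^n(\eta)).$$ 3. For all $i\in I$ and $\eta\in\partial_\infty$ the Martin kernel $\kappa(i,\eta)=\lim_{j\to\eta}V_{ij}/V_{rj}$ exists and $$\kappa(i,\eta)=1+\sum_{k=1}^{|i\wedge\eta|+1}\frac1{G_k(\eta)}\Big(\mathbb E_\mu(U_{i\bullet}\mid\mathcal F_k)(\eta)-\mathbb E_\mu(U_{i\bullet}\mid\mathcal F_{k-1})(\eta)\Big).$$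 -/

import Mathlib

open MeasureTheory ProbabilityTheory Filter Topology
open scoped ENNReal

noncomputable section

namespace TreePotential

/-! ### The minimal continuous time Markov chain of a conservative `q`-matrix -/

section Chain

variable {S : Type*}

open Classical in
/-- The one-step law of the discrete skeleton: from `i` the chain jumps to `j ≠ i` with probability
`Q i j / ∑ k ≠ i, Q i k`. A state without outgoing rates is absorbing. -/
def jumpPMF (Q : Matrix S S ℝ) (i : S) : PMF S :=
  let f : S → ℝ≥0∞ := fun j => if j = i then 0 else ENNReal.ofReal (Q i j)
  if h : ∑' j, f j ≠ 0 ∧ ∑' j, f j ≠ ∞ then PMF.normalize f h.1 h.2 else PMF.pure i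

variable [MeasurableSpace S] [DiscreteMeasurableSpace S]

/-- The transition kernel of the discrete skeleton. -/
def jumpKernel (Q : Matrix S S ℝ) : Kernel S S where
  toFun i := (jumpPMF Q i).toMeasure
  measurable' := Measurable.of_discrete

instance (Q : Matrix S S ℝ) : IsMarkovKernel (jumpKernel Q) :=
  ⟨fun i => PMF.toMeasure.isProbabilityMeasure (jumpPMF Q i)⟩

/-- The skeleton kernel, seen as a kernel that depends on the last point of a finite history. -/
def historyKernel (Q : Matrix S S ℝ) (n : ℕ) : Kernel (Finset.Iic n → S) S :=
  (jumpKernel Q).comap (fun x => x ⟨n, Finset.mem_Iic.2 le_rfl⟩) (measurable_pi_apply _)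

instance (Q : Matrix S S ℝ) (n : ℕ) : IsMarkovKernel (historyKernel Q n) := by
  unfold historyKernel; infer_instance

/-- The law of the discrete skeleton `(Y n)` started from `i`. -/
def skeletonLaw (Q : Matrix S S ℝ) (i : S) : Measure (ℕ → S) :=
  Kernel.traj (X := fun _ => S) (historyKernel Q) 0 (fun _ => i)

/-- Canonical space: `ω.1` is the path of the skeleton and `ω.2` a sequence of clocks. -/
abbrev PathSpace (S : Type*) := (ℕ → S) × (ℕ → ℝ)

/-- The law `ℙ_i`: the skeleton started from `i`, and independent unit exponential clocks. -/
def pathLaw (Q : Matrix S S ℝ) (i : S) : Measure (PathSpace S) :=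
  (skeletonLaw Q i).prod (Measure.infinitePi fun _ : ℕ => expMeasure 1)

/-- The time spent at the `n`-th state of the skeleton, exponential with rate `-Q` at this state
(infinite when the rate is `0`). -/
def holdingTime (Q : Matrix S S ℝ) (ω : PathSpace S) (n : ℕ) : ℝ≥0∞ :=
  ENNReal.ofReal (ω.2 n) / ENNReal.ofReal (-Q (ω.1 n) (ω.1 n))

/-- The time of the `n`-th jump. Their supremum is the lifetime `ζ`. -/
def jumpTime (Q : Matrix S S ℝ) (ω : PathSpace S) (n : ℕ) : ℝ≥0∞ :=
  ∑ m ∈ Finset.range n, holdingTime Q ω m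

open Classical in
/-- The position at time `t ≥ 0` of the minimal Markov process `X` with generator `Q`: the state
`Y n` of the skeleton if `t` lies between the `n`-th and the `(n+1)`-st jump, and `none` if `t` is
not smaller than the lifetime `ζ`. -/
def process (Q : Matrix S S ℝ) (t : ℝ) (ω : PathSpace S) : Option S :=
  if h : ∃ n, ENNReal.ofReal t < jumpTime Q ω (n + 1) then some (ω.1 (Nat.find h)) else none

/-- The minimal semigroup `P_t(i, j) = ℙ_i {X_t = j, t < ζ}`. -/
def semigroup (Q : Matrix S S ℝ) (t : ℝ) (i j : S) : ℝ≥0∞ :=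
  pathLaw Q i {ω | process Q t ω = some j}

/-- The potential `V = ∫₀^∞ P_t dt`. -/
def potential (Q : Matrix S S ℝ) (i j : S) : ℝ≥0∞ :=
  ∫⁻ t in Set.Ici (0 : ℝ), semigroup Q t i j

/-- `ℙ_i {T_j < ∞}`, where `T_j` is the hitting time of `j`. -/
def hittingProb (Q : Matrix S S ℝ) (i j : S) : ℝ≥0∞ :=
  pathLaw Q i {ω | ∃ t : ℝ, 0 ≤ t ∧ process Q t ω = some j}

end Chain

/-! ### The rooted tree and its boundary -/

section Tree

variable {I : Type*} (G : SimpleGraph I) (r : I)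

/-- `i ≼ j`: the site `i` lies on the geodesic from the root to `j`. -/
def Precedes (i j : I) : Prop := G.dist r i + G.dist i j = G.dist r j

/-- The boundary `∂_∞`: every end of the tree is represented by its unique geodesic
`(ξ(n) : n ∈ ℕ)` from the root, where `ξ(n)` is at level `n`. -/
def Boundary : Type _ :=
  {ξ : ℕ → I // (∀ n, G.dist r (ξ n) = n) ∧ ∀ n, G.Adj (ξ n) (ξ (n + 1))}

variable {G r}

instance : CoeFun (Boundary G r) (fun _ => ℕ → I) := ⟨Subtype.val⟩

variable (G r)

/-- `∂_∞(i)`: the boundary points whose geodesic from the root passes through `i`. -/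
def endsThrough (i : I) : Set (Boundary G r) := {ξ | ∃ n, ξ n = i}

/-- The topology on `I ∪ ∂_∞` generated by the singletons `{i}` and the extended subtrees
`[i, ∞]`, for `i` in `I`. -/
@[reducible] def treeTopology : TopologicalSpace (I ⊕ Boundary G r) :=
  TopologicalSpace.generateFrom
    (Set.range (fun i : I => {Sum.inl i}) ∪
      Set.range (fun i : I => Sum.inl '' {j | Precedes G r i j} ∪ Sum.inr '' endsThrough G r i))

variable {G r}

/-- The filter on `I` of the convergence `j → η`, for `η` in the boundary. -/
def toBoundary (η : Boundary G r) : Filter I :=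
  Filter.comap Sum.inl (@nhds _ (treeTopology G r) (Sum.inr η))

/-- The `σ`-field on `∂_∞` generated by the sets `∂_∞(i)`. -/
instance : MeasurableSpace (Boundary G r) :=
  MeasurableSpace.generateFrom (Set.range (endsThrough G r))

/-- `C^k(ξ) = ∂_∞(ξ(k))`. -/
def ball (k : ℕ) (ξ : Boundary G r) : Set (Boundary G r) := endsThrough G r (ξ k)

variable (G r)

/-- The filtration `(F_k)`: `F_k` is the `σ`-field generated by the partition
`{C^k(ξ) : ξ ∈ ∂_∞}` (the sets `C^j(ξ)`, `j ≤ k`, are finite unions of sets `C^k(ξ')`). -/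
def boundaryFiltration : Filtration ℕ (inferInstance : MeasurableSpace (Boundary G r)) where
  seq k := MeasurableSpace.generateFrom {A | ∃ j ≤ k, ∃ ξ : Boundary G r, A = ball j ξ}
  mono' := by
    intro k l hkl
    apply MeasurableSpace.generateFrom_mono
    rintro A ⟨j, hj, ξ, rfl⟩
    exact ⟨j, hj.trans hkl, ξ, rfl⟩
  le' := by
    intro k
    apply MeasurableSpace.generateFrom_mono
    rintro A ⟨j, -, ξ, rfl⟩
    exact ⟨ξ j, rfl⟩

variable {G r}

/-- `|i ∧ ξ|` for a site `i` and a boundary point `ξ`. -/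
def meetLevel (i : I) (ξ : Boundary G r) : ℕ := sSup {n | Precedes G r (ξ n) i}

/-- `U_{iξ} = w_{|i ∧ ξ|}` for a site `i` and a boundary point `ξ`. -/
def siteU (w : ℕ → ℝ) (i : I) (ξ : Boundary G r) : ℝ := w (meetLevel i ξ)

open Classical in
/-- `U_{ηξ}` for boundary points: `w_{|η ∧ ξ|}` if `η ≠ ξ`, and `lim w_n` (possibly infinite) if
`η = ξ`. -/
def boundaryU (w : ℕ → ℝ) (η ξ : Boundary G r) : ℝ≥0∞ :=
  if η = ξ then ⨆ n, ENNReal.ofReal (w n) else ENNReal.ofReal (w (sSup {n | η n = ξ n}))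

/-! ### The generators -/

/-- `Δ_n(w) = w_n - w_{n-1}`, with `w_{-1} = 0`. -/
def increment (w : ℕ → ℝ) : ℕ → ℝ
  | 0 => w 0
  | n + 1 => w (n + 1) - w n

variable (G r)

open Classical in
/-- The rate of the link between two sites: `(w_{|i|} - w_{|i|-1})⁻¹` between `i` and `i⁻`. -/
def linkRate (w : ℕ → ℝ) (i j : I) : ℝ :=
  if G.Adj i j then (increment w (max (G.dist r i) (G.dist r j)))⁻¹ else 0

open Classical in
/-- The symmetric conservative `q`-matrix on `I` supported by the tree and the diagonal
(reflection at the root). -/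
def reflectedQ [G.LocallyFinite] (w : ℕ → ℝ) : Matrix I I ℝ := fun i j =>
  if i = j then -∑ k ∈ G.neighborFinset i, linkRate G r w i k else linkRate G r w i j

open Classical in
/-- The conservative `q`-matrix on `I ∪ {∂_r}` of the tree matrix with level function `w`, with
absorption at `∂_r = ⊥`: there is the additional rate `1 / w₀` from the root to `∂_r`. -/
def absorbedQ [G.LocallyFinite] (w : ℕ → ℝ) : Matrix (WithBot I) (WithBot I) ℝ
  | ⊥, _ => 0
  | (i : I), ⊥ => if i = r then (w 0)⁻¹ else 0
  | (i : I), (j : I) => reflectedQ G r w i j - if i = r ∧ j = r then (w 0)⁻¹ else 0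

instance : MeasurableSpace (WithBot I) := ⊤

instance : DiscreteMeasurableSpace (WithBot I) := ⟨fun _ => trivial⟩

/-! ### The exit point -/

section Exit

variable {S : Type*} [MeasurableSpace S] [DiscreteMeasurableSpace S] (e : I → S)

/-- `X_ζ = η`: the states visited by the path converge to the boundary point `η`. Here `e` embeds
the sites in the state space. -/
def ExitsAt (ω : PathSpace S) (η : Boundary G r) : Prop :=
  Tendsto ω.1 atTop ((toBoundary η).map e)

/-- The event `{X_ζ ∈ ∂_∞}`. -/
def exitEvent : Set (PathSpace S) := {ω | ∃ η : Boundary G r, ExitsAt G r e ω η}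

/-- The measure `ℙ_i {X_ζ ∈ ·}` on `∂_∞`. -/
def exitLaw (Q : Matrix S S ℝ) (i : S) : Measure (Boundary G r) :=
  ((pathLaw Q i).comap (Subtype.val : exitEvent G r e → PathSpace S)).map (fun ω => ω.2.choose)

end Exit

/-- A boundary point `η` is regular if `ℙ_j {T_{∂_r} < ∞} → 0` as `j → η`. -/
def IsRegularPoint [G.LocallyFinite] (w : ℕ → ℝ) (η : Boundary G r) : Prop :=
  Tendsto (fun j : I => hittingProb (absorbedQ G r w) (j : WithBot I) ⊥) (toBoundary η) (𝓝 0)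

/-- `μ^{(a)} = ℙ_r {X^{(a)}_ζ ∈ · | X^{(a)}_ζ ∈ ∂_∞}`, where `X^{(a)}` is the chain with level
function `w + a`, absorbed at `∂_r`. -/
def absorbedExitLaw [G.LocallyFinite] (w : ℕ → ℝ) (a : ℝ) : Measure (Boundary G r) :=
  let ν := exitLaw G r (fun i => (i : WithBot I)) (absorbedQ G r fun n => w n + a) (r : WithBot I)
  (ν Set.univ)⁻¹ • ν

/-- `G^{(a)}_k(η) = ∑_{n ≥ k} Δ_n(w + a) μ^{(a)}(C^n(η))`. -/
def absorbedG [G.LocallyFinite] (w : ℕ → ℝ) (a : ℝ) (k : ℕ) (η : Boundary G r) : ℝ≥0∞ :=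
  ∑' n, ENNReal.ofReal (increment (fun n => w n + a) (k + n)) *
    absorbedExitLaw G r w a (ball (k + n) η)

end Tree

end TreePotential

end

open TreePotential

set_option linter.unusedSectionVars false

/-! Everything is expressed through one function `v`, the potential with pole at the root: it is
positive, its Laplacian is `-1` at the root and `0` elsewhere, and it vanishes at every end.
Regularity supplies it (`exists_isRootGreen`): the probability of being absorbed at `∂_r` is
harmonic away from the root and tends to `0` at the ends, so `v` is a multiple of it. The maximum
principle `nonpos_of_subharmonic`, which uses only that sites have children and that every ray
reaches an end, yields all comparison and uniqueness statements.

On a tree the potential with an arbitrary pole `j` is explicit in `v`. Cutting `v` off to the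
subtree below a site changes its Laplacian only across one edge, so a weighted sum of such cutoffs
along the geodesic from the root to `j` has telescoping Laplacian and moves the pole from the root
to `j` (`green`, `lap_green`). The probabilistic potential satisfies the same equation and is
dominated by this function, hence equals it (`potential_reflectedQ`).

The probability of exiting below `k` is the difference of the potentials with poles at `k⁻` and `k`,
divided by `Δ`, plus the indicator of the subtree: this is harmonic with the right boundary values.
At the root it gives `Δ_{|k|} μ(∂_∞(k)) = v(k⁻) - v(k)` (`IsExitLaw`). The sums defining `G`
therefore telescope, and since `v` vanishes at the ends, `G_{m+1}(η) = v(η(m))` and `G_0 = v(r) +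
w_0`. Absorption at the root multiplies all exit probabilities by one common factor, which
conditioning removes; so `G^{(a)}_k`, `k ≥ 1`, does not depend on `a ≥ 0` at all
(`IsExitLaw.absorbedG_eq`).

For the Martin kernel, `V_{ij} / V_{rj}` is already constant once `j` lies below the successor of
the confluent of `i` and `η`. Telescoping also gives `E(U_i | F_k)(η) = w_k + (v(η(k)) - v(i)) /
μ(C^k(η))` up to the confluent (`IsExitLaw.condExp_siteU`), and a summation by parts identifies the
two finite sums (`IsExitLaw.one_add_sum_condExp`). -/

namespace TreePotential

noncomputable section

/-! ### Predecessors, ancestors and the tree order -/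

section TreeStructure

variable {I : Type*} {T : SimpleGraph I} {r : I}

variable (T r) in
open Classical in
/-- The predecessor of a site; the root is its own predecessor. -/
def parent (i : I) : I :=
  if h : ∃ j, T.Adj i j ∧ T.dist r j + 1 = T.dist r i then h.choose else i

variable (T r) in
/-- The ancestor at level `n` of a site, which is the site itself if its level is at most `n`. -/
def anc (n : ℕ) (i : I) : I := (parent T r)^[T.dist r i - n] i

/-- Geodesics to `j` and to `k`, each extended by `i`, are two paths from the root to `i`. In a tree
they coincide, and `j` and `k` are their penultimate vertices. -/
theorem eq_of_adj_of_level_lt (hT : T.IsTree) {i j k : I} (hj : T.Adj i j) (hk : T.Adj i k)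
    (hj' : T.dist r j + 1 = T.dist r i) (hk' : T.dist r k + 1 = T.dist r i) : j = k := by
  classical
  obtain ⟨p, hp, hpl⟩ := hT.connected.exists_path_of_dist r j
  obtain ⟨q, hq, hql⟩ := hT.connected.exists_path_of_dist r k
  have hpi : i ∉ p.support := by
    intro h
    have h1 := T.dist_le (p.takeUntil i h)
    have h2 := p.length_takeUntil_le_length h
    omega
  have hqi : i ∉ q.support := by
    intro h
    have h1 := T.dist_le (q.takeUntil i h)
    have h2 := q.length_takeUntil_le_length h
    omega
  have h1 := hp.concat hpi hj.symm
  have h2 := hq.concat hqi hk.symm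
  have h3 : p.concat hj.symm = q.concat hk.symm :=
    congrArg Subtype.val ((hT.isAcyclic.subsingleton_path _ _).elim ⟨_, h1⟩ ⟨_, h2⟩)
  have h4 := congrArg SimpleGraph.Walk.penultimate h3
  simpa using h4

theorem exists_adj_level_lt (hT : T.IsTree) {i : I} (hi : i ≠ r) :
    ∃ j, T.Adj i j ∧ T.dist r j + 1 = T.dist r i := by
  obtain ⟨p, hpl⟩ := hT.connected.exists_walk_length_eq_dist i r
  cases p with
  | nil => exact absurd rfl hi
  | cons h q =>
    rename_i j
    refine ⟨j, h, ?_⟩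
    have h1 := T.dist_le q
    have h2 := hT.dist_eq_dist_add_one_of_adj r h
    rw [SimpleGraph.Walk.length_cons] at hpl
    rw [T.dist_comm (u := r) (v := j), T.dist_comm (u := r) (v := i)] at *
    omega

theorem adj_parent (hT : T.IsTree) {i : I} (hi : i ≠ r) : T.Adj i (parent T r i) := by
  have h := exists_adj_level_lt hT hi
  rw [parent, dif_pos h]
  exact h.choose_spec.1

theorem level_parent_add_one (hT : T.IsTree) {i : I} (hi : i ≠ r) :
    T.dist r (parent T r i) + 1 = T.dist r i := by
  have h := exists_adj_level_lt hT hi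
  rw [parent, dif_pos h]
  exact h.choose_spec.2

@[simp] theorem parent_root : parent T r r = r := by
  rw [parent, dif_neg]
  simp

theorem parent_eq (hT : T.IsTree) {i j : I} (h : T.Adj i j) (h' : T.dist r j + 1 = T.dist r i) :
    parent T r i = j := by
  have hi : i ≠ r := by rintro rfl; simp at h'
  exact eq_of_adj_of_level_lt hT (adj_parent hT hi) h (level_parent_add_one hT hi) h'

theorem level_eq_zero (hT : T.IsTree) {i : I} : T.dist r i = 0 ↔ i = r := by
  rw [hT.connected.dist_eq_zero_iff, eq_comm]

theorem level_parent (hT : T.IsTree) (i : I) : T.dist r (parent T r i) = T.dist r i - 1 := by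
  by_cases hi : i = r
  · subst hi; simp
  · have := level_parent_add_one hT hi; omega

theorem level_iterate_parent (hT : T.IsTree) (d : ℕ) (i : I) :
    T.dist r ((parent T r)^[d] i) = T.dist r i - d := by
  induction d with
  | zero => simp
  | succ d ih => rw [Function.iterate_succ_apply', level_parent hT, ih]; omega

/-- An edge joins a site with its predecessor. -/
theorem adj_cases (hT : T.IsTree) {i j : I} (h : T.Adj i j) :
    (parent T r j = i ∧ T.dist r j = T.dist r i + 1) ∨
      (parent T r i = j ∧ T.dist r i = T.dist r j + 1) := by
  rcases hT.dist_eq_dist_add_one_of_adj r h with h1 | h1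
  · exact Or.inr ⟨parent_eq hT h h1.symm, h1⟩
  · exact Or.inl ⟨parent_eq hT h.symm h1.symm, h1⟩

theorem adj_of_parent_eq (hT : T.IsTree) {i k : I} (hk : k ≠ r) (h : parent T r k = i) :
    T.Adj i k := by
  rw [← h]; exact (adj_parent hT hk).symm

theorem level_anc (hT : T.IsTree) (n : ℕ) (i : I) :
    T.dist r (anc T r n i) = min n (T.dist r i) := by
  rw [anc, level_iterate_parent hT]; omega

theorem anc_of_level_le {n : ℕ} {i : I} (h : T.dist r i ≤ n) : anc T r n i = i := by
  rw [anc, Nat.sub_eq_zero_of_le h]; rfl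

theorem anc_zero (hT : T.IsTree) (i : I) : anc T r 0 i = r := by
  rw [← level_eq_zero hT, level_anc hT]; simp

theorem anc_anc (hT : T.IsTree) {m n : ℕ} (h : m ≤ n) (i : I) :
    anc T r m (anc T r n i) = anc T r m i := by
  rw [anc, level_anc hT]
  rw [anc, ← Function.iterate_add_apply, anc]
  congr 1
  omega

theorem anc_parent (hT : T.IsTree) {n : ℕ} {i : I} (h : n < T.dist r i) :
    anc T r n (parent T r i) = anc T r n i := by
  rw [anc, level_parent hT, ← Function.iterate_succ_apply, anc]
  congr 1
  omega

theorem parent_anc {n : ℕ} {i : I} (h : n < T.dist r i) :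
    parent T r (anc T r (n + 1) i) = anc T r n i := by
  rw [anc, anc, ← Function.iterate_succ_apply' (parent T r)]
  congr 1
  omega

theorem anc_eq_of_adj (hT : T.IsTree) {n : ℕ} {i j : I} (h : T.Adj i j) (hi : n ≤ T.dist r i)
    (hj : n ≤ T.dist r j) : anc T r n i = anc T r n j := by
  rcases adj_cases (r := r) hT h with ⟨h1, h2⟩ | ⟨h1, h2⟩
  · rw [← h1, anc_parent hT (by omega)]
  · rw [← h1, anc_parent hT (by omega)]

/-- Replaces the metric definition of the order by iterated predecessors, the form used from here
on. One direction moves `j` towards `i` edge by edge without changing the relevant ancestor; the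
other bounds the distance from `j` to its ancestors by the number of steps and uses the triangle
inequality. -/
theorem precedes_iff (hT : T.IsTree) {i j : I} :
    Precedes T r i j ↔ T.dist r i ≤ T.dist r j ∧ anc T r (T.dist r i) j = i := by
  unfold Precedes
  constructor
  · intro h
    refine ⟨by omega, ?_⟩
    obtain ⟨d, hd⟩ : ∃ d, d = T.dist i j := ⟨_, rfl⟩
    induction d generalizing j with
    | zero =>
      have : i = j := hT.connected.dist_eq_zero_iff.1 hd.symm
      subst this
      exact anc_of_level_le le_rfl
    | succ d ih =>
      have hij : j ≠ i := by rintro rfl; simp at hd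
      -- Here `i` plays the role of the root: `k` is the neighbour of `j` closer to `i`.
      obtain ⟨k, hk, hk'⟩ := exists_adj_level_lt (r := i) hT hij
      have h1 := hT.dist_eq_dist_add_one_of_adj r hk
      have h2 := hT.connected.dist_triangle (u := r) (v := i) (w := k)
      have h3 := ih (j := k) (by omega) (by omega)
      rw [← h3, anc_eq_of_adj hT hk (by rw [h3]; omega) (by rw [h3]; omega), h3, h3]
  · rintro ⟨h1, h2⟩
    have key : ∀ d, d ≤ T.dist r j → T.dist (anc T r (T.dist r j - d) j) j ≤ d := by
      intro d
      induction d with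
      | zero => intro; simp [anc_of_level_le]
      | succ d ih =>
        intro hd
        have h3 := parent_anc (T := T) (r := r) (n := T.dist r j - (d + 1)) (i := j) (by omega)
        have h4 : T.dist r j - (d + 1) + 1 = T.dist r j - d := by omega
        rw [h4] at h3
        have h5 : anc T r (T.dist r j - d) j ≠ r := by
          rw [Ne, ← level_eq_zero hT, level_anc hT]; omega
        have h6 := adj_parent hT h5
        rw [h3] at h6
        have h7 := hT.connected.dist_triangle (u := anc T r (T.dist r j - (d + 1)) j)
          (v := anc T r (T.dist r j - d) j) (w := j)
        have h8 := SimpleGraph.dist_eq_one_iff_adj.2 h6.symm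
        have := ih (by omega)
        omega
    have h3 := key (T.dist r j - T.dist r i) (by omega)
    rw [show T.dist r j - (T.dist r j - T.dist r i) = T.dist r i by omega, h2] at h3
    have h4 := hT.connected.dist_triangle (u := r) (v := i) (w := j)
    omega

theorem precedes_refl (i : I) : Precedes T r i i := by simp [Precedes]

theorem root_precedes (j : I) : Precedes T r r j := by simp [Precedes]

theorem precedes_anc (hT : T.IsTree) (n : ℕ) (i : I) : Precedes T r (anc T r n i) i := by
  rw [precedes_iff hT, level_anc hT]
  refine ⟨min_le_right _ _, ?_⟩
  rcases le_total n (T.dist r i) with h | h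
  · rw [min_eq_left h]
  · rw [min_eq_right h, anc_of_level_le le_rfl, anc_of_level_le h]

theorem precedes_trans (hT : T.IsTree) {i j k : I} (hij : Precedes T r i j)
    (hjk : Precedes T r j k) : Precedes T r i k := by
  rw [precedes_iff hT] at *
  refine ⟨hij.1.trans hjk.1, ?_⟩
  rw [← anc_anc hT hij.1, hjk.2, hij.2]

/-- The subtree below a site other than the root is left only through the site. -/
theorem precedes_iff_of_adj (hT : T.IsTree) {i j k : I} (h : T.Adj j k)
    (h1 : ¬ (j = i ∧ k = parent T r i)) (h2 : ¬ (k = i ∧ j = parent T r i)) :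
    Precedes T r i j ↔ Precedes T r i k := by
  have key : ∀ {j k : I}, parent T r k = j → T.dist r k = T.dist r j + 1 →
      ¬ (k = i ∧ j = parent T r i) → (Precedes T r i j ↔ Precedes T r i k) := by
    intro j k hp hl hn
    rw [precedes_iff hT, precedes_iff hT]
    constructor
    · rintro ⟨h3, h4⟩
      refine ⟨by omega, ?_⟩
      rw [← anc_parent hT (by omega), hp, h4]
    · rintro ⟨h3, h4⟩
      rcases Nat.lt_or_ge (T.dist r i) (T.dist r k) with h5 | h5
      · refine ⟨by omega, ?_⟩
        rw [← hp, anc_parent hT h5, h4]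
      · rw [anc_of_level_le h5] at h4
        subst h4
        exact absurd ⟨rfl, hp.symm⟩ hn
  rcases adj_cases (r := r) hT h with ⟨h3, h4⟩ | ⟨h3, h4⟩
  · exact key h3 h4 h2
  · exact (key h3 h4 h1).symm

/-- An infinite branch contains a strict descendant of `i`, whose ancestor one level below `i` is a
child. The absence of leaves makes the maximum principle work. -/
theorem exists_child (hT : T.IsTree) (hbranch : ∀ i, {j | Precedes T r i j}.Infinite) (i : I) :
    ∃ k, T.Adj i k ∧ T.dist r k = T.dist r i + 1 ∧ parent T r k = i := by
  obtain ⟨j, hj, hji⟩ := (hbranch i).exists_notMem_finite (Set.finite_singleton i)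
  have hj' := (precedes_iff hT).1 hj
  have hlt : T.dist r i < T.dist r j := by
    refine lt_of_le_of_ne hj'.1 fun h => hji ?_
    rw [Set.mem_singleton_iff, ← hj'.2, anc_of_level_le h.ge]
  have h1 : parent T r (anc T r (T.dist r i + 1) j) = i := by rw [parent_anc hlt, hj'.2]
  have h2 : T.dist r (anc T r (T.dist r i + 1) j) = T.dist r i + 1 := by
    rw [level_anc hT]; omega
  refine ⟨_, adj_of_parent_eq hT ?_ h1, h2, h1⟩
  rw [Ne, ← level_eq_zero hT]; omega

end TreeStructure

/-! ### Ends of the tree and convergence to them -/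

section Ends

variable {I : Type*} {T : SimpleGraph I} {r : I}

theorem Boundary.level (ξ : Boundary T r) (n : ℕ) : T.dist r (ξ n) = n := ξ.2.1 n

theorem Boundary.adj (ξ : Boundary T r) (n : ℕ) : T.Adj (ξ n) (ξ (n + 1)) := ξ.2.2 n

theorem Boundary.parent_succ (hT : T.IsTree) (ξ : Boundary T r) (n : ℕ) :
    parent T r (ξ (n + 1)) = ξ n :=
  parent_eq hT (ξ.adj n).symm (by rw [ξ.level, ξ.level])

theorem Boundary.zero (hT : T.IsTree) (ξ : Boundary T r) : ξ 0 = r := by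
  rw [← level_eq_zero hT, ξ.level]

theorem Boundary.anc (hT : T.IsTree) (ξ : Boundary T r) {m n : ℕ} (h : m ≤ n) :
    TreePotential.anc T r m (ξ n) = ξ m := by
  induction n, h using Nat.le_induction with
  | base => exact anc_of_level_le (ξ.level m).le
  | succ n h ih => rw [← anc_parent hT (by rw [ξ.level]; omega), ξ.parent_succ hT, ih]

theorem Boundary.precedes (hT : T.IsTree) (ξ : Boundary T r) {m n : ℕ} (h : m ≤ n) :
    Precedes T r (ξ m) (ξ n) := by
  rw [precedes_iff hT, ξ.level, ξ.level]
  exact ⟨h, ξ.anc hT h⟩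

theorem Boundary.ext' {ξ η : Boundary T r} (h : ∀ n, ξ n = η n) : ξ = η :=
  Subtype.ext (funext h)

theorem Boundary.eq_of_le (hT : T.IsTree) {ξ η : Boundary T r} {m n : ℕ} (h : m ≤ n)
    (hn : ξ n = η n) : ξ m = η m := by
  rw [← ξ.anc hT h, hn, η.anc hT h]

theorem mem_endsThrough {ξ : Boundary T r} {i : I} :
    ξ ∈ endsThrough T r i ↔ ξ (T.dist r i) = i := by
  constructor
  · rintro ⟨n, rfl⟩
    rw [ξ.level]
  · exact fun h => ⟨_, h⟩

theorem mem_ball {ξ η : Boundary T r} {n : ℕ} : ξ ∈ ball n η ↔ ξ n = η n := by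
  rw [ball, mem_endsThrough, η.level]

theorem endsThrough_root (hT : T.IsTree) : endsThrough T r r = Set.univ :=
  Set.eq_univ_of_forall fun ξ => ⟨0, ξ.zero hT⟩

theorem measurableSet_endsThrough (i : I) : MeasurableSet (endsThrough T r i) :=
  MeasurableSpace.measurableSet_generateFrom ⟨i, rfl⟩

/-- Singletons of sites do not contain `η`, so only the extended subtrees along the geodesic of `η`
matter among the generators, and these are nested. -/
theorem toBoundary_hasBasis (hT : T.IsTree) (η : Boundary T r) :
    (toBoundary η).HasBasis (fun _ : ℕ => True) fun n => {j | Precedes T r (η n) j} := by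
  have key : toBoundary η = ⨅ n : ℕ, 𝓟 {j | Precedes T r (η n) j} := by
    rw [toBoundary, TopologicalSpace.nhds_generateFrom, comap_iInf]
    simp only [comap_iInf, comap_principal]
    apply le_antisymm
    · refine le_iInf fun n => ?_
      refine (iInf₂_le (Sum.inl '' {j | Precedes T r (η n) j} ∪
        Sum.inr '' endsThrough T r (η n)) ?_).trans ?_
      · refine ⟨Or.inr ⟨η, ⟨n, rfl⟩, rfl⟩, Or.inr ⟨η n, rfl⟩⟩
      · rw [principal_mono]
        rintro j (⟨k, hk, h⟩ | ⟨k, hk, h⟩)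
        · cases h; exact hk
        · cases h
    · refine le_iInf₂ ?_
      rintro s ⟨hs, ⟨i, rfl⟩ | ⟨i, rfl⟩⟩
      · cases hs
      · have hi : η ∈ endsThrough T r i := by
          rcases hs with ⟨k, hk, h⟩ | ⟨k, hk, h⟩
          · cases h
          · cases h; exact hk
        obtain ⟨n, rfl⟩ := hi
        refine (iInf_le _ n).trans ?_
        rw [principal_mono]
        exact fun j hj => Or.inl ⟨j, hj, rfl⟩
  rw [key]
  refine hasBasis_iInf_principal ?_
  intro m n
  refine ⟨max m n, ?_, ?_⟩
  · exact fun j hj => precedes_trans hT (η.precedes hT (le_max_left _ _)) hj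
  · exact fun j hj => precedes_trans hT (η.precedes hT (le_max_right _ _)) hj

theorem tendsto_toBoundary (hT : T.IsTree) (η : Boundary T r) :
    Tendsto (fun n => η n) atTop (toBoundary η) := by
  rw [(toBoundary_hasBasis hT η).tendsto_right_iff]
  intro n _
  filter_upwards [eventually_ge_atTop n] with m hm using η.precedes hT hm

/-- A sequence of sites, each the predecessor of the next one, extends to a geodesic from the
root. -/
theorem exists_boundary_of_rays (hT : T.IsTree) (x : ℕ → I)
    (hx : ∀ m, parent T r (x (m + 1)) = x m)
    (hl : ∀ m, T.dist r (x (m + 1)) = T.dist r (x m) + 1) :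
    ∃ η : Boundary T r, ∀ m, η (T.dist r (x 0) + m) = x m := by
  have hl' : ∀ m, T.dist r (x m) = T.dist r (x 0) + m := by
    intro m
    induction m with
    | zero => rfl
    | succ m ih => rw [hl, ih]; omega
  have hit : ∀ d m, (parent T r)^[d] (x (d + m)) = x m := by
    intro d
    induction d with
    | zero => intro m; simp
    | succ d ih =>
      intro m
      rw [Function.iterate_succ_apply, show d + 1 + m = (d + m) + 1 by omega, hx, ih]
  have hlev : ∀ n, T.dist r ((parent T r)^[T.dist r (x 0)] (x n)) = n := by
    intro n
    rw [level_iterate_parent hT, hl']; omega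
  -- The site `x n` has level `|x 0| + n`; going up `|x 0|` levels from it lands at level `n`, which
  -- also fills in the geodesic from the root to `x 0`.
  refine ⟨⟨fun n => (parent T r)^[T.dist r (x 0)] (x n), hlev, fun n => ?_⟩, fun m => hit _ m⟩
  refine adj_of_parent_eq (r := r) hT ?_ ?_
  · rw [Ne, ← level_eq_zero hT, hlev]; omega
  · rw [← Function.iterate_succ_apply' (parent T r), Function.iterate_succ_apply, hx]

end Ends

/-! ### The Laplacian of the tree and its maximum principle -/

section Laplacian

variable {I : Type*} {T : SimpleGraph I} {r : I}

theorem increment_pos {w : ℕ → ℝ} (hpos : ∀ n, 0 < w n) (hmono : StrictMono w) (n : ℕ) :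
    0 < increment w n := by
  cases n with
  | zero => exact hpos 0
  | succ n => exact sub_pos.2 (hmono n.lt_succ_self)

theorem sum_increment (w : ℕ → ℝ) (n : ℕ) : ∑ m ∈ Finset.range (n + 1), increment w m = w n := by
  induction n with
  | zero => simp [increment]
  | succ n ih => rw [Finset.sum_range_succ, ih, increment]; ring

theorem linkRate_comm (w : ℕ → ℝ) (i j : I) : linkRate T r w i j = linkRate T r w j i := by
  by_cases h : T.Adj i j
  · rw [linkRate, linkRate, if_pos h, if_pos h.symm, max_comm]
  · rw [linkRate, linkRate, if_neg h, if_neg fun h' => h h'.symm]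

theorem linkRate_pos {w : ℕ → ℝ} (hpos : ∀ n, 0 < w n) (hmono : StrictMono w) {i j : I}
    (h : T.Adj i j) : 0 < linkRate T r w i j := by
  rw [linkRate, if_pos h]
  exact inv_pos.2 (increment_pos hpos hmono _)

theorem linkRate_nonneg {w : ℕ → ℝ} (hpos : ∀ n, 0 < w n) (hmono : StrictMono w) (i j : I) :
    0 ≤ linkRate T r w i j := by
  by_cases h : T.Adj i j
  · exact (linkRate_pos hpos hmono h).le
  · rw [linkRate, if_neg h]

theorem linkRate_parent (hT : T.IsTree) (w : ℕ → ℝ) {i : I} (hi : i ≠ r) :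
    linkRate T r w i (parent T r i) = (increment w (T.dist r i))⁻¹ := by
  have := level_parent_add_one hT hi
  rw [linkRate, if_pos (adj_parent hT hi), max_eq_left (by omega)]

variable [T.LocallyFinite]

variable (T r) in
/-- The action of the reflected `q`-matrix on a function. -/
def lap (w : ℕ → ℝ) (f : I → ℝ) (i : I) : ℝ :=
  ∑ k ∈ T.neighborFinset i, linkRate T r w i k * (f k - f i)

variable (T r) in
/-- The total rate of the jumps from a site. -/
def totalRate (w : ℕ → ℝ) (i : I) : ℝ := ∑ k ∈ T.neighborFinset i, linkRate T r w i k

theorem lap_eq (w : ℕ → ℝ) (f : I → ℝ) (i : I) :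
    lap T r w f i = ∑ k ∈ T.neighborFinset i, linkRate T r w i k * f k -
      totalRate T r w i * f i := by
  simp only [lap, totalRate, mul_sub, Finset.sum_sub_distrib, Finset.sum_mul]

theorem lap_add (w : ℕ → ℝ) (f g : I → ℝ) (i : I) :
    lap T r w (fun k => f k + g k) i = lap T r w f i + lap T r w g i := by
  simp only [lap, ← Finset.sum_add_distrib]
  exact Finset.sum_congr rfl fun k _ => by ring

theorem lap_sub (w : ℕ → ℝ) (f g : I → ℝ) (i : I) :
    lap T r w (fun k => f k - g k) i = lap T r w f i - lap T r w g i := by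
  simp only [lap, ← Finset.sum_sub_distrib]
  exact Finset.sum_congr rfl fun k _ => by ring

theorem lap_const_mul (w : ℕ → ℝ) (c : ℝ) (f : I → ℝ) (i : I) :
    lap T r w (fun k => c * f k) i = c * lap T r w f i := by
  simp only [lap, Finset.mul_sum]
  exact Finset.sum_congr rfl fun k _ => by ring

theorem lap_neg (w : ℕ → ℝ) (f : I → ℝ) (i : I) :
    lap T r w (fun k => - f k) i = - lap T r w f i := by
  have := lap_const_mul (T := T) (r := r) w (-1) f i
  simpa using this

theorem lap_const (w : ℕ → ℝ) (c : ℝ) (i : I) : lap T r w (fun _ => c) i = 0 := by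
  simp [lap]

theorem totalRate_pos (hT : T.IsTree) (hbranch : ∀ i, {j | Precedes T r i j}.Infinite)
    {w : ℕ → ℝ} (hpos : ∀ n, 0 < w n) (hmono : StrictMono w) (i : I) :
    0 < totalRate T r w i := by
  obtain ⟨k, hk, -⟩ := exists_child hT hbranch i
  exact Finset.sum_pos (fun k hk => linkRate_pos hpos hmono ((T.mem_neighborFinset i k).1 hk))
    ⟨k, (T.mem_neighborFinset i k).2 hk⟩

/-- Maximum principle: a function which is subharmonic where it is positive, and which is
asymptotically nonpositive along each end, is nonpositive. -/
theorem nonpos_of_subharmonic (hT : T.IsTree) (hbranch : ∀ i, {j | Precedes T r i j}.Infinite)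
    {w : ℕ → ℝ} (hpos : ∀ n, 0 < w n) (hmono : StrictMono w) {h : I → ℝ}
    (hsub : ∀ i, 0 < h i → 0 ≤ lap T r w h i)
    (hend : ∀ η : Boundary T r, ∀ ε > 0, ∀ᶠ n in atTop, h (η n) < ε) (i : I) : h i ≤ 0 := by
  classical
  by_contra! hi
  have hex : ∃ n, ∃ i, T.dist r i = n ∧ 0 < h i := ⟨_, i, rfl, hi⟩
  -- A positive site of minimal level dominates its predecessor, which starts an upward climb along
  -- a ray.
  obtain ⟨i₀, hi₀, hpos₀⟩ := Nat.find_spec hex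
  have hmin : ∀ j, T.dist r j < T.dist r i₀ → h j ≤ 0 := by
    intro j hj
    by_contra! hj'
    exact Nat.find_min hex (hi₀ ▸ hj) ⟨j, rfl, hj'⟩
  -- If the predecessor does not exceed `i` and all children were strictly smaller, the Laplacian at
  -- `i` would be negative; so some child is at least as large.
  have hstep : ∀ i, 0 < h i → h (parent T r i) ≤ h i →
      ∃ k, T.Adj i k ∧ T.dist r k = T.dist r i + 1 ∧ parent T r k = i ∧ h i ≤ h k := by
    intro i h0 hp
    by_contra! hcon
    have hle : ∀ k ∈ T.neighborFinset i, linkRate T r w i k * (h k - h i) ≤ 0 := by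
      intro k hk
      have hk := (T.mem_neighborFinset i k).1 hk
      refine mul_nonpos_of_nonneg_of_nonpos (linkRate_nonneg hpos hmono i k) ?_
      rcases adj_cases (r := r) hT hk with ⟨h1, h2⟩ | ⟨h1, h2⟩
      · linarith [hcon k hk h2 h1]
      · rw [← h1]; linarith
    obtain ⟨k, hk, h1, h2⟩ := exists_child hT hbranch i
    have := Finset.sum_lt_sum (s := T.neighborFinset i)
      (f := fun k => linkRate T r w i k * (h k - h i)) (g := fun _ => 0) hle
      ⟨k, (T.mem_neighborFinset i k).2 hk,
        mul_neg_of_pos_of_neg (linkRate_pos hpos hmono hk) (by linarith [hcon k hk h1 h2])⟩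
    rw [Finset.sum_const_zero] at this
    exact absurd (hsub i h0) (not_le.2 this)
  have hstart : h (parent T r i₀) ≤ h i₀ := by
    by_cases hr : i₀ = r
    · rw [hr, parent_root]
    · have := level_parent_add_one hT hr
      linarith [hmin (parent T r i₀) (by omega)]
  let A := {i : I // 0 < h i ∧ h (parent T r i) ≤ h i}
  have hstep' : ∀ a : A, ∃ b : A, T.dist r b.1 = T.dist r a.1 + 1 ∧ parent T r b.1 = a.1 ∧
      h a.1 ≤ h b.1 := by
    rintro ⟨i, h0, hp⟩
    obtain ⟨k, h1, h2, h3, h4⟩ := hstep i h0 hp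
    exact ⟨⟨k, h0.trans_le h4, by rw [h3]; exact h4⟩, h2, h3, h4⟩
  choose c hc using hstep'
  let a₀ : A := ⟨i₀, hpos₀, hstart⟩
  have hmonotone : ∀ m, h i₀ ≤ h (c^[m] a₀).1 := by
    intro m
    induction m with
    | zero => exact le_rfl
    | succ m ih => rw [Function.iterate_succ_apply']; exact ih.trans (hc _).2.2
  obtain ⟨η, hη⟩ := exists_boundary_of_rays (r := r) hT (fun m => (c^[m] a₀).1)
    (fun m => by simp only [Function.iterate_succ_apply']; exact (hc _).2.1)
    (fun m => by simp only [Function.iterate_succ_apply']; exact (hc _).1)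
  -- Along the constructed ray `h` never falls below `h i₀ > 0`, against the assumption at its end.
  obtain ⟨N, hN⟩ := eventually_atTop.1 (hend η (h i₀) hpos₀)
  have h1 := hN (T.dist r i₀ + N) (by omega)
  have h2 := hη N
  simp only [Function.iterate_zero, id] at h2
  rw [show T.dist r a₀.1 = T.dist r i₀ from rfl] at h2
  rw [h2] at h1
  linarith [hmonotone N]

end Laplacian

/-! ### The discrete skeleton: Markov property, Green function, harmonic functions -/

section Skeleton

variable {S : Type*}

/-- The indicator function of a state. -/
def pointMass (j : S) : S → ℝ≥0∞ := Set.indicator {j} 1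

@[simp] theorem pointMass_self (j : S) : pointMass j j = 1 := by simp [pointMass]

theorem pointMass_of_ne {i j : S} (h : i ≠ j) : pointMass j i = 0 := by simp [pointMass, h]

/-- The one-step average of a function under the skeleton. -/
def avg (Q : Matrix S S ℝ) (f : S → ℝ≥0∞) (s : S) : ℝ≥0∞ := ∑' z, jumpPMF Q s z * f z

theorem avg_mono (Q : Matrix S S ℝ) {f g : S → ℝ≥0∞} (h : ∀ s, f s ≤ g s) (s : S) :
    avg Q f s ≤ avg Q g s :=
  ENNReal.tsum_le_tsum fun z => mul_le_mul_right (h z) _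

/-- Monotone convergence, with the series read as an integral for the counting measure. -/
theorem avg_iSup (Q : Matrix S S ℝ) {f : ℕ → S → ℝ≥0∞} (hf : ∀ s, Monotone fun n => f n s)
    (s : S) : avg Q (fun z => ⨆ n, f n z) s = ⨆ n, avg Q (f n) s := by
  simp only [avg, ENNReal.mul_iSup]
  let _ : MeasurableSpace S := ⊤
  rw [← lintegral_count, lintegral_iSup (fun n => measurable_from_top)]
  · simp only [lintegral_count]
  · exact fun m n h z => mul_le_mul_right (hf z h) _

variable [MeasurableSpace S] [DiscreteMeasurableSpace S]

instance (Q : Matrix S S ℝ) (s : S) : IsProbabilityMeasure (skeletonLaw Q s) := by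
  unfold skeletonLaw; infer_instance

instance (Q : Matrix S S ℝ) (s : S) : IsProbabilityMeasure (pathLaw Q s) := by
  have : IsProbabilityMeasure (expMeasure 1) := isProbabilityMeasure_expMeasure one_pos
  unfold pathLaw; infer_instance

variable [Countable S]

theorem lintegral_jumpKernel (Q : Matrix S S ℝ) (f : S → ℝ≥0∞) (s : S) :
    ∫⁻ z, f z ∂jumpKernel Q s = avg Q f s := by
  rw [lintegral_countable', avg]
  refine tsum_congr fun z => ?_
  rw [mul_comm]
  congr 1
  exact PMF.toMeasure_apply_singleton _ _ (measurableSet_singleton z)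

/-- The Markov property of the skeleton. -/
theorem lintegral_skeletonLaw_succ (Q : Matrix S S ℝ) (s : S) (n : ℕ) (f : S → S → ℝ≥0∞) :
    ∫⁻ y, f (y n) (y (n + 1)) ∂skeletonLaw Q s =
      ∫⁻ y, avg Q (f (y n)) (y n) ∂skeletonLaw Q s := by
  have hf : Measurable (Function.uncurry f) := Measurable.of_discrete
  have hm : Measurable fun p : (Finset.Iic n → S) × S =>
      f (p.1 ⟨n, Finset.mem_Iic.2 le_rfl⟩) p.2 := by
    have hp : Measurable fun p : (Finset.Iic n → S) × S =>
        (p.1 ⟨n, Finset.mem_Iic.2 le_rfl⟩, p.2) := by fun_prop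
    exact hf.comp hp
  have h1 := Kernel.partialTraj_compProd_eq_map_traj (X := fun _ => S) (κ := historyKernel Q)
    (Nat.zero_le n) (x₀ := fun _ => s)
  -- The pair consisting of the history up to `n` and the next state has as law the composition
  -- product of the history law and the step kernel, so the last coordinate can be integrated first.
  have h2 : ∫⁻ y, f (y n) (y (n + 1)) ∂skeletonLaw Q s =
      ∫⁻ p, f (p.1 ⟨n, Finset.mem_Iic.2 le_rfl⟩) p.2 ∂((skeletonLaw Q s).map
        (fun x ↦ (Preorder.frestrictLe (π := fun _ => S) n x, x (n + 1)))) := by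
    rw [lintegral_map hm (by fun_prop)]
    rfl
  rw [h2, skeletonLaw, ← h1, Measure.lintegral_compProd hm,
    ← Kernel.traj_map_frestrictLe_apply, lintegral_map]
  · refine lintegral_congr fun y => ?_
    rw [← lintegral_jumpKernel]
    rfl
  · exact Measurable.lintegral_kernel_prod_right' hm
  · fun_prop

theorem lintegral_skeletonLaw_zero (Q : Matrix S S ℝ) (s : S) (f : S → ℝ≥0∞) :
    ∫⁻ y, f (y 0) ∂skeletonLaw Q s = f s := by
  have hm : Measurable fun y : ℕ → S => f (y 0) :=
    (Measurable.of_discrete (f := f)).comp (measurable_pi_apply 0)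
  rw [skeletonLaw, Kernel.lintegral_traj _ hm]
  simp [Function.updateFinset]

theorem lintegral_skeletonLaw (Q : Matrix S S ℝ) (s : S) (n : ℕ) (f : S → ℝ≥0∞) :
    ∫⁻ y, f (y n) ∂skeletonLaw Q s = (avg Q)^[n] f s := by
  induction n generalizing f with
  | zero => exact lintegral_skeletonLaw_zero Q s f
  | succ n ih =>
    rw [lintegral_skeletonLaw_succ Q s n fun _ => f, Function.iterate_succ_apply, ← ih]

theorem measurableSet_skeleton_eq (n : ℕ) (j : S) : MeasurableSet {y : ℕ → S | y n = j} := by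
  have h : Measurable fun y : ℕ → S => y n := measurable_pi_apply n
  exact h (measurableSet_singleton j)

theorem skeletonLaw_eq (Q : Matrix S S ℝ) (s : S) (n : ℕ) (j : S) :
    skeletonLaw Q s {y | y n = j} = (avg Q)^[n] (pointMass j) s := by
  rw [← lintegral_skeletonLaw, ← lintegral_indicator_one (measurableSet_skeleton_eq n j)]
  refine lintegral_congr fun y => ?_
  by_cases h : y n = j
  · simp [Set.indicator, h]
  · simp [Set.indicator, h, pointMass_of_ne h]

/-- The indicator of a forbidden jump has one-step average `0`, hence expectation `0` by the Markov
property. -/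
theorem ae_skeletonLaw_jump (Q : Matrix S S ℝ) (s : S) :
    ∀ᵐ y ∂skeletonLaw Q s, ∀ n, jumpPMF Q (y n) (y (n + 1)) ≠ 0 := by
  classical
  rw [ae_all_iff]
  intro n
  let f : S → S → ℝ≥0∞ := fun x z => if jumpPMF Q x z = 0 then 1 else 0
  have h := lintegral_skeletonLaw_succ Q s n f
  have h0 : ∀ x, avg Q (f x) x = 0 := by
    intro x
    rw [avg, ENNReal.tsum_eq_zero]
    intro z
    by_cases hz : jumpPMF Q x z = 0
    · simp [hz]
    · simp [f, hz]
  simp only [h0, lintegral_zero] at h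
  have hf : Measurable (Function.uncurry f) := Measurable.of_discrete
  have hp : Measurable fun y : ℕ → S => (y n, y (n + 1)) := by fun_prop
  have hm : Measurable fun y : ℕ → S => f (y n) (y (n + 1)) := hf.comp hp
  rw [lintegral_eq_zero_iff hm] at h
  filter_upwards [h] with y hy hzero
  simp [f, hzero] at hy

/-- The expected number of visits. -/
def visits (Q : Matrix S S ℝ) (s j : S) : ℝ≥0∞ := ∑' n, skeletonLaw Q s {y | y n = j}

/-- First-step decomposition: the visit at time `0` is split off. -/
theorem visits_eq (Q : Matrix S S ℝ) (s j : S) :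
    visits Q s j = pointMass j s + avg Q (fun z => visits Q z j) s := by
  simp only [visits, skeletonLaw_eq]
  rw [tsum_eq_zero_add' ENNReal.summable]
  congr 1
  simp only [avg, ← ENNReal.tsum_mul_left]
  rw [ENNReal.tsum_comm]
  refine tsum_congr fun n => ?_
  rw [Function.iterate_succ_apply']
  rfl

/-- The Green function is the least supersolution: by induction every partial sum stays below `φ`,
since one further step is again an average. -/
theorem visits_le (Q : Matrix S S ℝ) (j : S) {φ : S → ℝ≥0∞}
    (hφ : ∀ s, pointMass j s + avg Q φ s ≤ φ s) (s : S) : visits Q s j ≤ φ s := by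
  have key : ∀ N s, ∑ n ∈ Finset.range N, (avg Q)^[n] (pointMass j) s ≤ φ s := by
    intro N
    induction N with
    | zero => simp
    | succ N ih =>
      intro s
      rw [Finset.sum_range_succ']
      have : ∑ n ∈ Finset.range N, (avg Q)^[n + 1] (pointMass j) s =
          avg Q (fun z => ∑ n ∈ Finset.range N, (avg Q)^[n] (pointMass j) z) s := by
        simp only [avg, Finset.mul_sum]
        rw [Summable.tsum_finsetSum fun _ _ => ENNReal.summable]
        refine Finset.sum_congr rfl fun n _ => ?_
        rw [Function.iterate_succ_apply']
        rfl
      rw [this, add_comm]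
      exact (add_le_add_right (avg_mono Q ih s) _).trans (hφ s)
  simp only [visits, skeletonLaw_eq]
  rw [ENNReal.tsum_eq_iSup_nat]
  exact iSup_le fun N => key N s

/-- First Borel–Cantelli lemma. -/
theorem ae_finite_visits (Q : Matrix S S ℝ) (s j : S) (h : visits Q s j ≠ ∞) :
    ∀ᵐ y ∂skeletonLaw Q s, ∀ᶠ n in atTop, y n ≠ j := by
  have := ae_eventually_notMem (μ := skeletonLaw Q s) (s := fun n => {y : ℕ → S | y n = j}) h
  exact this

/-- The limit along the paths of a bounded harmonic function represents this function. -/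
theorem harmonic_eq_lintegral_lim (Q : Matrix S S ℝ) (s : S) {g : S → ℝ≥0∞}
    (hg : ∀ x, avg Q g x = g x) {C : ℝ≥0∞} (hC : C ≠ ∞) (hbdd : ∀ x, g x ≤ C)
    {L : (ℕ → S) → ℝ≥0∞}
    (hL : ∀ᵐ y ∂skeletonLaw Q s, Tendsto (fun n => g (y n)) atTop (𝓝 (L y))) :
    g s = ∫⁻ y, L y ∂skeletonLaw Q s := by
  have h1 : ∀ n, ∫⁻ y, g (y n) ∂skeletonLaw Q s = g s := by
    intro n
    rw [lintegral_skeletonLaw]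
    induction n with
    | zero => rfl
    | succ n ih => rw [Function.iterate_succ_apply, show avg Q g = g from funext hg, ih]
  have h2 := tendsto_lintegral_of_dominated_convergence (μ := skeletonLaw Q s)
    (F := fun n y => g (y n)) (f := L) (fun _ => C)
    (fun n => (Measurable.of_discrete (f := g)).comp (measurable_pi_apply n))
    (fun n => ae_of_all _ fun y => hbdd _) (by simpa using hC) hL
  simp only [h1] at h2
  exact tendsto_nhds_unique tendsto_const_nhds h2

end Skeleton

/-! ### Exponential clocks and the passage to continuous time -/

section Clocks

variable {S : Type*} [MeasurableSpace S] [DiscreteMeasurableSpace S]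

/-- As `Γ(1) = Γ(2) = 1`, multiplying the exponential density by `x` gives the Gamma density of
shape `2`, of total mass `1`. -/
theorem lintegral_ofReal_expMeasure : ∫⁻ x, ENNReal.ofReal x ∂expMeasure 1 = 1 := by
  have hm : Measurable (gammaPDF 1 1) :=
    ENNReal.measurable_ofReal.comp (measurable_gammaPDFReal 1 1)
  rw [expMeasure, gammaMeasure, lintegral_withDensity_eq_lintegral_mul _ hm
    ENNReal.measurable_ofReal, ← lintegral_gammaPDF_eq_one (a := 2) (r := 1) two_pos one_pos]
  refine lintegral_congr fun x => ?_
  rcases lt_or_ge x 0 with hx | hx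
  · simp [gammaPDF_of_neg hx]
  · have h2 : Real.Gamma 2 = 1 := Real.Gamma_two
    rw [Pi.mul_apply, gammaPDF_of_nonneg hx, gammaPDF_of_nonneg hx,
      ← ENNReal.ofReal_mul (by positivity)]
    congr 1
    rw [Real.Gamma_one, h2, show (2 : ℝ) - 1 = 1 by norm_num]
    simp [mul_comm]

theorem ae_pos_expMeasure : ∀ᵐ x ∂expMeasure 1, 0 < x := by
  have hm : Measurable (gammaPDF 1 1) :=
    ENNReal.measurable_ofReal.comp (measurable_gammaPDFReal 1 1)
  rw [expMeasure, gammaMeasure, ae_withDensity_iff hm]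
  have h0 : ∀ᵐ x : ℝ, x ≠ 0 := by simp [ae_iff]
  filter_upwards [h0] with x hx hx'
  rcases lt_or_gt_of_ne hx with h | h
  · exact absurd (gammaPDF_of_neg h) hx'
  · exact h

theorem ae_pathLaw_clock_pos (Q : Matrix S S ℝ) (s : S) : ∀ᵐ ω ∂pathLaw Q s, ∀ n, 0 < ω.2 n := by
  have : IsProbabilityMeasure (expMeasure 1) := isProbabilityMeasure_expMeasure one_pos
  have h : ∀ᵐ c ∂Measure.infinitePi (fun _ : ℕ => expMeasure 1), ∀ n, 0 < c n := by
    rw [ae_all_iff]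
    intro n
    exact (measurePreserving_eval_infinitePi (fun _ : ℕ => expMeasure 1)
      n).quasiMeasurePreserving.ae ae_pos_expMeasure
  exact Measure.quasiMeasurePreserving_snd.ae h

theorem pathLaw_skeleton (Q : Matrix S S ℝ) (s : S) {A : Set (ℕ → S)} (hA : MeasurableSet A) :
    pathLaw Q s {ω | ω.1 ∈ A} = skeletonLaw Q s A := by
  have : IsProbabilityMeasure (expMeasure 1) := isProbabilityMeasure_expMeasure one_pos
  have h : (pathLaw Q s).map Prod.fst = skeletonLaw Q s := by
    rw [pathLaw]; exact Measure.fst_prod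
  rw [← h, Measure.map_apply measurable_fst hA]
  rfl

theorem jumpTime_succ (Q : Matrix S S ℝ) (ω : PathSpace S) (n : ℕ) :
    jumpTime Q ω (n + 1) = jumpTime Q ω n + holdingTime Q ω n := by
  rw [jumpTime, Finset.sum_range_succ]; rfl

theorem jumpTime_mono (Q : Matrix S S ℝ) (ω : PathSpace S) : Monotone (jumpTime Q ω) :=
  monotone_nat_of_le_succ fun n => by rw [jumpTime_succ]; exact le_self_add

theorem process_eq_some_iff (Q : Matrix S S ℝ) (t : ℝ) (ω : PathSpace S) (j : S) :
    process Q t ω = some j ↔ ∃ n, jumpTime Q ω n ≤ ENNReal.ofReal t ∧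
      ENNReal.ofReal t < jumpTime Q ω (n + 1) ∧ ω.1 n = j := by
  classical
  unfold process
  constructor
  · intro h
    split_ifs at h with hex
    refine ⟨_, ?_, Nat.find_spec hex, Option.some_injective _ h⟩
    rcases hn : Nat.find hex with _ | n
    · simp [jumpTime]
    · exact not_lt.1 (Nat.find_min hex (m := n) (by omega))
  · rintro ⟨n, h1, h2, rfl⟩
    have hex : ∃ n, ENNReal.ofReal t < jumpTime Q ω (n + 1) := ⟨n, h2⟩
    rw [dif_pos hex]
    have : Nat.find hex = n := (Nat.find_eq_iff hex).2
      ⟨h2, fun m hm => not_lt.2 ((jumpTime_mono Q ω hm).trans h1)⟩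
    rw [this]

variable [Countable S]

theorem measurable_holdingTime (Q : Matrix S S ℝ) (n : ℕ) :
    Measurable fun ω : PathSpace S => holdingTime Q ω n := by
  unfold holdingTime
  refine Measurable.div (by fun_prop) ?_
  exact (Measurable.of_discrete (f := fun i : S => ENNReal.ofReal (-Q i i))).comp
    ((measurable_pi_apply n).comp measurable_fst)

theorem measurable_jumpTime (Q : Matrix S S ℝ) (n : ℕ) :
    Measurable fun ω : PathSpace S => jumpTime Q ω n :=
  Finset.measurable_fun_sum _ fun m _ => measurable_holdingTime Q m

theorem measurableSet_process (Q : Matrix S S ℝ) (j : S) :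
    MeasurableSet {p : ℝ × PathSpace S | process Q p.1 p.2 = some j} := by
  simp only [process_eq_some_iff, Set.ofPred_exists]
  refine MeasurableSet.iUnion fun n => ?_
  have ht : Measurable fun p : ℝ × PathSpace S => ENNReal.ofReal p.1 := by fun_prop
  refine (measurableSet_le ((measurable_jumpTime Q n).comp measurable_snd) ht).inter
    ((measurableSet_lt ht ((measurable_jumpTime Q (n + 1)).comp measurable_snd)).inter ?_)
  exact (measurable_snd.fst) (measurableSet_skeleton_eq n j)

theorem volume_ofReal_between {a b : ℝ≥0∞} (ha : a ≠ ∞) (hb : b ≠ ∞) :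
    volume {t : ℝ | 0 ≤ t ∧ a ≤ ENNReal.ofReal t ∧ ENNReal.ofReal t < b} = b - a := by
  have : {t : ℝ | 0 ≤ t ∧ a ≤ ENNReal.ofReal t ∧ ENNReal.ofReal t < b} =
      Set.Ico a.toReal b.toReal := by
    ext t
    simp only [Set.mem_ofPred_eq, Set.mem_Ico]
    constructor
    · rintro ⟨h0, h1, h2⟩
      exact ⟨(ENNReal.le_ofReal_iff_toReal_le ha h0).1 h1,
        (ENNReal.ofReal_lt_iff_lt_toReal h0 hb).1 h2⟩
    · rintro ⟨h1, h2⟩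
      have h0 : 0 ≤ t := ENNReal.toReal_nonneg.trans h1
      exact ⟨h0, (ENNReal.le_ofReal_iff_toReal_le ha h0).2 h1,
        (ENNReal.ofReal_lt_iff_lt_toReal h0 hb).2 h2⟩
  rw [this, Real.volume_Ico, ENNReal.ofReal_sub _ ENNReal.toReal_nonneg, ENNReal.ofReal_toReal ha,
    ENNReal.ofReal_toReal hb]

theorem holdingTime_ne_top {Q : Matrix S S ℝ} (hQ : ∀ i, Q i i < 0) (ω : PathSpace S) (n : ℕ) :
    holdingTime Q ω n ≠ ∞ := by
  refine ENNReal.div_ne_top ENNReal.ofReal_ne_top ?_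
  rw [Ne, ENNReal.ofReal_eq_zero, not_le]
  linarith [hQ (ω.1 n)]

open Classical in
/-- The total time spent at `j`. -/
theorem volume_process {Q : Matrix S S ℝ} (hQ : ∀ i, Q i i < 0) (ω : PathSpace S) (j : S) :
    volume {t : ℝ | 0 ≤ t ∧ process Q t ω = some j} =
      ∑' n, if ω.1 n = j then holdingTime Q ω n else 0 := by
  have hfin : ∀ n, jumpTime Q ω n ≠ ∞ := fun n =>
    ENNReal.sum_ne_top.2 fun m _ => holdingTime_ne_top hQ ω m
  let A : ℕ → Set ℝ := fun n => {t : ℝ | ω.1 n = j ∧ 0 ≤ t ∧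
    jumpTime Q ω n ≤ ENNReal.ofReal t ∧ ENNReal.ofReal t < jumpTime Q ω (n + 1)}
  have h1 : {t : ℝ | 0 ≤ t ∧ process Q t ω = some j} = ⋃ n, A n := by
    ext t
    simp only [process_eq_some_iff, Set.mem_ofPred_eq, Set.mem_iUnion, A]
    constructor
    · rintro ⟨h0, n, h1, h2, h3⟩; exact ⟨n, h3, h0, h1, h2⟩
    · rintro ⟨n, h3, h0, h1, h2⟩; exact ⟨h0, n, h1, h2, h3⟩
  have hA : ∀ n, MeasurableSet (A n) := by
    intro n
    have ht : Measurable fun t : ℝ => ENNReal.ofReal t := by fun_prop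
    exact (MeasurableSet.const _).inter (measurableSet_Ici.inter
      ((measurableSet_le measurable_const ht).inter (measurableSet_lt ht measurable_const)))
  have hd : Pairwise (Function.onFun Disjoint A) := by
    have key : ∀ m n, m < n → Disjoint (A m) (A n) := by
      intro m n hmn
      rw [Set.disjoint_left]
      rintro t ⟨-, -, -, h2⟩ ⟨-, -, h3, -⟩
      exact absurd (h2.trans_le (jumpTime_mono Q ω hmn)) (not_lt.2 h3)
    intro m n hmn
    rcases lt_or_gt_of_ne hmn with h | h
    · exact key m n h
    · exact (key n m h).symm
  rw [h1, measure_iUnion hd hA]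
  refine tsum_congr fun n => ?_
  split_ifs with h
  · simp only [A, h, true_and]
    rw [volume_ofReal_between (hfin n) (hfin _), jumpTime_succ,
      ENNReal.add_sub_cancel_left (hfin n)]
  · simp [A, h]

/-- The potential is the Green function of the skeleton divided by the total rate. -/
theorem potential_eq {Q : Matrix S S ℝ} (hQ : ∀ i, Q i i < 0) (i j : S) :
    potential Q i j = visits Q i j / ENNReal.ofReal (-Q j j) := by
  have : IsProbabilityMeasure (expMeasure 1) := isProbabilityMeasure_expMeasure one_pos
  have hms := measurableSet_process Q j
  have hsec : ∀ ω : PathSpace S, MeasurableSet {t : ℝ | process Q t ω = some j} := fun ω =>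
    (measurable_id.prodMk measurable_const) hms
  have hsec' : ∀ t : ℝ, MeasurableSet {ω : PathSpace S | process Q t ω = some j} := fun t =>
    (measurable_const.prodMk measurable_id) hms
  have h1 : potential Q i j = ∫⁻ t in Set.Ici (0 : ℝ), ∫⁻ ω,
      {p : ℝ × PathSpace S | process Q p.1 p.2 = some j}.indicator 1 (t, ω) ∂pathLaw Q i := by
    rw [potential]
    refine lintegral_congr fun t => ?_
    rw [semigroup, ← lintegral_indicator_one (hsec' t)]
    rfl
  have hf : Measurable ({p : ℝ × PathSpace S | process Q p.1 p.2 = some j}.indicator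
      (1 : ℝ × PathSpace S → ℝ≥0∞)) := measurable_one.indicator hms
  -- Tonelli: the potential is the expected total time spent at `j`.
  rw [h1, lintegral_lintegral_swap (f := fun (t : ℝ) (ω : PathSpace S) =>
    {p : ℝ × PathSpace S | process Q p.1 p.2 = some j}.indicator 1 (t, ω)) hf.aemeasurable]
  have h2 : ∀ ω : PathSpace S, ∫⁻ t in Set.Ici (0 : ℝ),
      {p : ℝ × PathSpace S | process Q p.1 p.2 = some j}.indicator 1 (t, ω) =
        ∑' n, {y : ℕ → S | y n = j}.indicator (fun _ => (ENNReal.ofReal (-Q j j))⁻¹) ω.1 *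
          ENNReal.ofReal (ω.2 n) := by
    intro ω
    have : ∀ t : ℝ, {p : ℝ × PathSpace S | process Q p.1 p.2 = some j}.indicator
        (1 : ℝ × PathSpace S → ℝ≥0∞) (t, ω) =
          {t : ℝ | process Q t ω = some j}.indicator 1 t := fun t => rfl
    simp only [this]
    rw [lintegral_indicator_one (hsec ω), Measure.restrict_apply (hsec ω), Set.inter_comm]
    refine (volume_process hQ ω j).trans (tsum_congr fun n => ?_)
    by_cases h : ω.1 n = j
    · simp [h, holdingTime, div_eq_mul_inv, mul_comm]
    · simp [h]
  simp only [h2]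
  have hm1 : ∀ n, Measurable ({y : ℕ → S | y n = j}.indicator
      fun _ => (ENNReal.ofReal (-Q j j))⁻¹) := fun n =>
    measurable_const.indicator (measurableSet_skeleton_eq n j)
  rw [lintegral_tsum fun n => by
    exact (((hm1 n).comp measurable_fst).mul (by fun_prop)).aemeasurable]
  rw [visits, div_eq_mul_inv, ← ENNReal.tsum_mul_right]
  refine tsum_congr fun n => ?_
  -- Skeleton and clocks are independent and each clock has mean `1`, so each visit to `j`
  -- contributes the inverse of the total rate on average.
  rw [pathLaw, lintegral_prod_mul (f := {y : ℕ → S | y n = j}.indicator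
      fun _ => (ENNReal.ofReal (-Q j j))⁻¹) (g := fun c : ℕ → ℝ => ENNReal.ofReal (c n))
    (hm1 n).aemeasurable (by exact Measurable.aemeasurable (by fun_prop)),
    lintegral_indicator_const (measurableSet_skeleton_eq n j)]
  have h3 : ∫⁻ c, ENNReal.ofReal (c n) ∂Measure.infinitePi (fun _ : ℕ => expMeasure 1) = 1 := by
    rw [← lintegral_ofReal_expMeasure]
    exact (measurePreserving_eval_infinitePi (fun _ : ℕ => expMeasure 1) n).lintegral_comp
      ENNReal.measurable_ofReal
  rw [h3, mul_one, mul_comm]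

/-- If only the state `j` is absorbing, then the process reaches `j` when its skeleton does. -/
theorem skeletonLaw_le_hittingProb {Q : Matrix S S ℝ} {j : S} (hj : Q j j = 0)
    (hQ : ∀ i, i ≠ j → Q i i < 0) (s : S) (n : ℕ) :
    skeletonLaw Q s {y | y n = j} ≤ hittingProb Q s j := by
  classical
  rw [← pathLaw_skeleton Q s (measurableSet_skeleton_eq n j), hittingProb]
  refine measure_mono_ae ?_
  filter_upwards [ae_pathLaw_clock_pos Q s] with ω hω hn
  have hex : ∃ n, ω.1 n = j := ⟨n, hn⟩
  have hm := Nat.find_spec hex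
  have hmin : ∀ k < Nat.find hex, ω.1 k ≠ j := fun k hk => Nat.find_min hex hk
  generalize Nat.find hex = m at hm hmin
  have hfin : jumpTime Q ω m ≠ ∞ := by
    refine ENNReal.sum_ne_top.2 fun k hk => ENNReal.div_ne_top ENNReal.ofReal_ne_top ?_
    rw [Ne, ENNReal.ofReal_eq_zero, not_le]
    linarith [hQ _ (hmin k (Finset.mem_range.1 hk))]
  -- The rate at `j` is `0`, so the holding time is a quotient by `0`. It is infinite only because
  -- the clock is positive: in `ℝ≥0∞` one has `0 / 0 = 0`.
  have htop : holdingTime Q ω m = ∞ := by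
    rw [holdingTime, hm, hj]
    simp [ENNReal.div_zero, hω m]
  refine ⟨(jumpTime Q ω m).toReal, ENNReal.toReal_nonneg, ?_⟩
  rw [process_eq_some_iff]
  refine ⟨m, ?_, ?_, hm⟩
  · rw [ENNReal.ofReal_toReal hfin]
  · rw [ENNReal.ofReal_toReal hfin, jumpTime_succ, htop]
    simpa using hfin.lt_top

end Clocks

/-! ### Jump probabilities for finitely supported rates -/

section Rates

variable {S : Type*}

open Classical in
/-- The skeleton jumps according to the rates, when these are finitely supported. -/
theorem jumpPMF_eq (Q : Matrix S S ℝ) (i : S) (F : Finset S) (hi : i ∉ F)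
    (hF : ∀ z ∈ F, 0 ≤ Q i z) (h0 : ∀ z, z ∉ F → z ≠ i → Q i z = 0)
    (hpos : 0 < ∑ z ∈ F, Q i z) (z : S) :
    jumpPMF Q i z =
      if z = i then 0 else ENNReal.ofReal (Q i z) / ENNReal.ofReal (∑ z ∈ F, Q i z) := by
  have hsum : ∑' j, (if j = i then 0 else ENNReal.ofReal (Q i j)) =
      ENNReal.ofReal (∑ z ∈ F, Q i z) := by
    rw [tsum_eq_sum (s := F), ENNReal.ofReal_sum_of_nonneg hF]
    · refine Finset.sum_congr rfl fun z hz => if_neg ?_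
      rintro rfl
      exact hi hz
    · intro z hz
      by_cases h : z = i
      · rw [if_pos h]
      · rw [if_neg h, h0 z hz h, ENNReal.ofReal_zero]
  have hcond : ∑' j, (if j = i then 0 else ENNReal.ofReal (Q i j)) ≠ 0 ∧
      ∑' j, (if j = i then 0 else ENNReal.ofReal (Q i j)) ≠ ∞ := by
    rw [hsum]
    exact ⟨by simpa using hpos, ENNReal.ofReal_ne_top⟩
  have hdef : jumpPMF Q i = PMF.normalize (fun j => if j = i then 0 else ENNReal.ofReal (Q i j))
      hcond.1 hcond.2 := by
    unfold jumpPMF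
    rw [dif_pos]
    exact hcond
  rw [hdef, PMF.normalize_apply, hsum]
  split_ifs
  · simp
  · rw [div_eq_mul_inv]

/-- The bridge from `ℝ≥0∞`-valued averages to real finite sums, through which harmonicity for the
skeleton becomes an equation for the Laplacian. -/
theorem avg_ofReal (Q : Matrix S S ℝ) (i : S) (F : Finset S) (hi : i ∉ F)
    (hF : ∀ z ∈ F, 0 ≤ Q i z) (h0 : ∀ z, z ∉ F → z ≠ i → Q i z = 0)
    (hpos : 0 < ∑ z ∈ F, Q i z) {f : S → ℝ} (hf : ∀ z, 0 ≤ f z) :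
    avg Q (fun z => ENNReal.ofReal (f z)) i =
      ENNReal.ofReal ((∑ z ∈ F, Q i z * f z) / ∑ z ∈ F, Q i z) := by
  rw [avg, tsum_eq_sum (s := F), ENNReal.ofReal_div_of_pos hpos,
    ENNReal.ofReal_sum_of_nonneg (fun z hz => mul_nonneg (hF z hz) (hf z)), div_eq_mul_inv,
    Finset.sum_mul]
  · refine Finset.sum_congr rfl fun z hz => ?_
    rw [jumpPMF_eq Q i F hi hF h0 hpos, if_neg (by rintro rfl; exact hi hz),
      ENNReal.ofReal_mul (hF z hz), div_eq_mul_inv]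
    ring
  · intro z hz
    rw [jumpPMF_eq Q i F hi hF h0 hpos]
    by_cases h : z = i
    · simp [h]
    · simp [h, h0 z hz h]

end Rates

/-! ### The reflected and the absorbed generator -/

section Generators

variable {I : Type*} {T : SimpleGraph I} [T.LocallyFinite] {r : I} {w : ℕ → ℝ}

theorem reflectedQ_self (i : I) : reflectedQ T r w i i = -totalRate T r w i := by
  rw [reflectedQ, if_pos rfl, totalRate]

theorem reflectedQ_of_ne {i j : I} (h : i ≠ j) : reflectedQ T r w i j = linkRate T r w i j := by
  rw [reflectedQ, if_neg h]

theorem linkRate_of_not_adj {i j : I} (h : ¬ T.Adj i j) : linkRate T r w i j = 0 := by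
  rw [linkRate, if_neg h]

theorem sum_reflectedQ (i : I) (f : I → ℝ) :
    ∑ z ∈ T.neighborFinset i, reflectedQ T r w i z * f z =
      ∑ z ∈ T.neighborFinset i, linkRate T r w i z * f z := by
  refine Finset.sum_congr rfl fun z hz => ?_
  rw [reflectedQ_of_ne ((T.mem_neighborFinset i z).1 hz).ne]

theorem sum_reflectedQ_one (i : I) :
    ∑ z ∈ T.neighborFinset i, reflectedQ T r w i z = totalRate T r w i := by
  simpa [totalRate] using sum_reflectedQ (T := T) (r := r) (w := w) i 1

theorem avg_reflectedQ (hT : T.IsTree) (hbranch : ∀ i, {j | Precedes T r i j}.Infinite)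
    (hpos : ∀ n, 0 < w n) (hmono : StrictMono w) {f : I → ℝ} (hf : ∀ i, 0 ≤ f i) (i : I) :
    avg (reflectedQ T r w) (fun z => ENNReal.ofReal (f z)) i =
      ENNReal.ofReal ((∑ k ∈ T.neighborFinset i, linkRate T r w i k * f k) /
        totalRate T r w i) := by
  rw [avg_ofReal _ i (T.neighborFinset i) _ _ _ _ hf, sum_reflectedQ, sum_reflectedQ_one]
  · simp
  · intro z hz
    rw [reflectedQ_of_ne ((T.mem_neighborFinset i z).1 hz).ne]
    exact linkRate_nonneg hpos hmono i z
  · intro z hz hzi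
    rw [reflectedQ_of_ne hzi.symm]
    exact linkRate_of_not_adj fun h => hz ((T.mem_neighborFinset i z).2 h)
  · rw [sum_reflectedQ_one]
    exact totalRate_pos hT hbranch hpos hmono i

variable (r w) in
open Classical in
/-- The rate of absorption at a site. -/
def killRate (i : I) : ℝ := if i = r then (w 0)⁻¹ else 0

theorem killRate_nonneg (hpos : ∀ n, 0 < w n) (i : I) : 0 ≤ killRate r w i := by
  unfold killRate
  split_ifs
  · exact (inv_pos.2 (hpos 0)).le
  · exact le_rfl

theorem absorbedQ_bot (i : I) : absorbedQ T r w i ⊥ = killRate r w i := rfl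

open Classical in
theorem absorbedQ_of_ne {i j : I} (h : i ≠ j) :
    absorbedQ T r w i j = linkRate T r w i j := by
  have h' : ¬ (i = r ∧ j = r) := fun h'' => h (h''.1.trans h''.2.symm)
  have : absorbedQ T r w i j = reflectedQ T r w i j - if i = r ∧ j = r then (w 0)⁻¹ else 0 := by
    simp only [absorbedQ]
  rw [this, if_neg h', sub_zero, reflectedQ_of_ne h]

open Classical in
theorem absorbedQ_self (i : I) :
    absorbedQ T r w i i = -(killRate r w i + totalRate T r w i) := by
  have : absorbedQ T r w i i = reflectedQ T r w i i - killRate r w i := by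
    simp only [absorbedQ, killRate, and_self]
  rw [this, reflectedQ_self]
  ring

variable (T) in
/-- The possible targets of a jump of the absorbed chain. -/
def absorbedTargets (i : I) : Finset (WithBot I) :=
  Finset.cons ⊥ ((T.neighborFinset i).map ⟨WithBot.some, WithBot.coe_injective⟩) (by simp)

theorem coe_mem_absorbedTargets {i k : I} : (k : WithBot I) ∈ absorbedTargets T i ↔ T.Adj i k := by
  simp [absorbedTargets]

theorem sum_absorbedQ (i : I) (f : WithBot I → ℝ) :
    ∑ z ∈ absorbedTargets T i, absorbedQ T r w i z * f z =
      killRate r w i * f ⊥ + ∑ k ∈ T.neighborFinset i, linkRate T r w i k * f k := by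
  rw [absorbedTargets, Finset.sum_cons, Finset.sum_map, absorbedQ_bot]
  congr 1
  refine Finset.sum_congr rfl fun z hz => ?_
  simp only [Function.Embedding.coeFn_mk]
  rw [absorbedQ_of_ne ((T.mem_neighborFinset i z).1 hz).ne]

theorem sum_absorbedQ_one (i : I) :
    ∑ z ∈ absorbedTargets T i, absorbedQ T r w i z = killRate r w i + totalRate T r w i := by
  simpa [totalRate] using sum_absorbedQ (T := T) (r := r) (w := w) i 1

theorem absorbedQ_conditions (hT : T.IsTree) (hbranch : ∀ i, {j | Precedes T r i j}.Infinite)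
    (hpos : ∀ n, 0 < w n) (hmono : StrictMono w) (i : I) :
    (i : WithBot I) ∉ absorbedTargets T i ∧
    (∀ z ∈ absorbedTargets T i, 0 ≤ absorbedQ T r w i z) ∧
    (∀ z, z ∉ absorbedTargets T i → z ≠ i → absorbedQ T r w i z = 0) ∧
    0 < ∑ z ∈ absorbedTargets T i, absorbedQ T r w i z := by
  refine ⟨?_, ?_, ?_, ?_⟩
  · rw [coe_mem_absorbedTargets]
    exact T.irrefl
  · intro z hz
    cases z with
    | bot => exact killRate_nonneg hpos i
    | coe k =>
      rw [coe_mem_absorbedTargets] at hz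
      rw [absorbedQ_of_ne hz.ne]
      exact linkRate_nonneg hpos hmono i k
  · intro z hz hzi
    cases z with
    | bot => simp [absorbedTargets] at hz
    | coe k =>
      rw [coe_mem_absorbedTargets] at hz
      rw [absorbedQ_of_ne (fun h => hzi (by rw [h]))]
      exact linkRate_of_not_adj hz
  · rw [sum_absorbedQ_one]
    exact add_pos_of_nonneg_of_pos (killRate_nonneg hpos i) (totalRate_pos hT hbranch hpos hmono i)

theorem avg_absorbedQ (hT : T.IsTree) (hbranch : ∀ i, {j | Precedes T r i j}.Infinite)
    (hpos : ∀ n, 0 < w n) (hmono : StrictMono w) {f : WithBot I → ℝ} (hf : ∀ i, 0 ≤ f i)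
    (i : I) :
    avg (absorbedQ T r w) (fun z => ENNReal.ofReal (f z)) i =
      ENNReal.ofReal ((killRate r w i * f ⊥ +
        ∑ k ∈ T.neighborFinset i, linkRate T r w i k * f k) /
          (killRate r w i + totalRate T r w i)) := by
  obtain ⟨h1, h2, h3, h4⟩ := absorbedQ_conditions hT hbranch hpos hmono i
  rw [avg_ofReal _ _ _ h1 h2 h3 h4 hf, sum_absorbedQ, sum_absorbedQ_one]

theorem jumpPMF_absorbedQ_bot : jumpPMF (absorbedQ T r w) ⊥ = PMF.pure ⊥ := by
  unfold jumpPMF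
  rw [dif_neg]
  simp [absorbedQ]

theorem avg_absorbedQ_bot (f : WithBot I → ℝ≥0∞) : avg (absorbedQ T r w) f ⊥ = f ⊥ := by
  rw [avg, jumpPMF_absorbedQ_bot, tsum_eq_single ⊥]
  · simp
  · intro z hz
    simp [hz]

/-- The absorbed chain moves to nearest neighbours until it is absorbed. -/
theorem adj_of_jumpPMF_absorbedQ (hT : T.IsTree)
    (hbranch : ∀ i, {j | Precedes T r i j}.Infinite)
    (hpos : ∀ n, 0 < w n) (hmono : StrictMono w) {i k : I}
    (h : jumpPMF (absorbedQ T r w) i k ≠ 0) : T.Adj i k := by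
  obtain ⟨h1, h2, h3, h4⟩ := absorbedQ_conditions hT hbranch hpos hmono i
  rw [jumpPMF_eq _ _ _ h1 h2 h3 h4] at h
  by_contra hadj
  apply h
  by_cases hik : (k : WithBot I) = i
  · rw [if_pos hik]
  · rw [if_neg hik, h3 _ (by rwa [coe_mem_absorbedTargets]) hik]
    simp

end Generators

/-! ### The potential with pole at the root, from regularity -/

section RootGreen

variable {I : Type*} {T : SimpleGraph I} [T.LocallyFinite] {r : I} {w : ℕ → ℝ}

variable (T r w) in
open Classical in
/-- The Green function with pole at the root: positive, vanishing at the ends. -/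
structure IsRootGreen (v : I → ℝ) : Prop where
  pos : ∀ i, 0 < v i
  lap_eq : ∀ i, lap T r w v i = -if i = r then 1 else 0
  tendsto : ∀ η : Boundary T r, Tendsto v (toBoundary η) (𝓝 0)

/-- A nonnegative function with the right Laplacian has no zero. -/
theorem pos_of_lap_eq (hT : T.IsTree) (hpos : ∀ n, 0 < w n) (hmono : StrictMono w) {v : I → ℝ}
    (h0 : ∀ i, 0 ≤ v i) (hr : lap T r w v r < 0) (hlap : ∀ i, i ≠ r → lap T r w v i = 0) (i : I) :
    0 < v i := by
  have hroot : 0 < v r := by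
    by_contra hcon
    have hz : v r = 0 := le_antisymm (not_lt.1 hcon) (h0 r)
    refine absurd hr (not_lt.2 (Finset.sum_nonneg fun k _ => ?_))
    rw [hz, sub_zero]
    exact mul_nonneg (linkRate_nonneg hpos hmono _ _) (h0 k)
  obtain ⟨n, hn⟩ : ∃ n, n = T.dist r i := ⟨_, rfl⟩
  induction n generalizing i with
  | zero => rw [(level_eq_zero hT).1 hn.symm]; exact hroot
  | succ n ih =>
    have hi : i ≠ r := by rw [Ne, ← level_eq_zero hT]; omega
    have hp := ih (parent T r i) (by have := level_parent_add_one hT hi; omega)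
    by_contra hcon
    have hz : v i = 0 := le_antisymm (not_lt.1 hcon) (h0 i)
    have hl := hlap i hi
    rw [lap, Finset.sum_eq_zero_iff_of_nonneg (fun k _ => by
      rw [hz, sub_zero]; exact mul_nonneg (linkRate_nonneg hpos hmono _ _) (h0 k))] at hl
    have h1 := hl (parent T r i) ((T.mem_neighborFinset _ _).2 (adj_parent hT hi))
    rw [hz, sub_zero] at h1
    exact absurd h1 (mul_pos (linkRate_pos hpos hmono (adj_parent hT hi)) hp).ne'

open Classical in
-- Let `x` be the probability that the absorbed skeleton ever reaches `∂_r`. First-step analysis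
-- gives `x` the Laplacian `-(1 - x(r)) / w_0` at the root and `0` elsewhere; regularity gives the
-- limit `0` at the ends. It remains to see that `x(r) < 1` and to normalise.
theorem exists_isRootGreen [Countable I] (hT : T.IsTree)
    (hbranch : ∀ i, {j | Precedes T r i j}.Infinite)
    (hpos : ∀ n, 0 < w n) (hmono : StrictMono w)
    (hregular : ∀ η : Boundary T r, IsRegularPoint T r w η) : ∃ v, IsRootGreen T r w v := by
  have : Countable (WithBot I) := inferInstanceAs (Countable (Option I))
  set Q := absorbedQ T r w with hQ
  let uN : ℕ → WithBot I → ℝ≥0∞ := fun n => (avg Q)^[n] (pointMass ⊥)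
  have huN : ∀ n s, uN n s = skeletonLaw Q s {y | y n = ⊥} := fun n s =>
    (skeletonLaw_eq Q s n ⊥).symm
  -- Since `⊥` is absorbing, the probability of being there at time `n` increases with `n`; its
  -- supremum is the probability of ever reaching it.
  have hstep : ∀ n s, uN n s ≤ uN (n + 1) s := by
    intro n
    induction n with
    | zero =>
      intro s
      simp only [uN, zero_add, Function.iterate_one, Function.iterate_zero, id]
      cases s with
      | bot => rw [avg_absorbedQ_bot]
      | coe i => rw [pointMass_of_ne WithBot.coe_ne_bot]; exact zero_le
    | succ n ih =>
      intro s
      have h1 : uN (n + 1) = avg Q (uN n) := Function.iterate_succ_apply' _ _ _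
      have h2 : uN (n + 1 + 1) = avg Q (uN (n + 1)) := Function.iterate_succ_apply' _ _ _
      rw [h1, h2]
      exact avg_mono Q ih s
  have huMono : ∀ s, Monotone fun n => uN n s := fun s => monotone_nat_of_le_succ fun n => hstep n s
  let u : WithBot I → ℝ≥0∞ := fun s => ⨆ n, uN n s
  have hu1 : ∀ s, u s ≤ 1 := fun s => iSup_le fun n => by rw [huN]; exact prob_le_one
  have huTop : ∀ s, u s ≠ ∞ := fun s => ((hu1 s).trans_lt ENNReal.one_lt_top).ne
  have hubot : u ⊥ = 1 := le_antisymm (hu1 ⊥) (le_iSup_of_le 0 (by simp [uN]))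
  have hharm : ∀ s, avg Q u s = u s := by
    intro s
    rw [avg_iSup Q huMono]
    have h1 : ∀ n, avg Q (uN n) s = uN (n + 1) s := fun n => by
      rw [show uN (n + 1) = avg Q (uN n) from Function.iterate_succ_apply' _ _ _]
    simp only [h1, u]
    exact (huMono s).iSup_nat_add 1
  have hhit : ∀ i : I, u i ≤ hittingProb Q i ⊥ := by
    intro i
    refine iSup_le fun n => ?_
    rw [huN]
    refine skeletonLaw_le_hittingProb (by simp [hQ, absorbedQ]) ?_ _ _
    intro s hs
    cases s with
    | bot => exact absurd rfl hs
    | coe k =>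
      rw [hQ, absorbedQ_self]
      have := killRate_nonneg (r := r) hpos k
      have := totalRate_pos hT hbranch hpos hmono k
      linarith
  let f : WithBot I → ℝ := fun s => (u s).toReal
  have hf0 : ∀ s, 0 ≤ f s := fun s => ENNReal.toReal_nonneg
  have hfu : (fun s => ENNReal.ofReal (f s)) = u := funext fun s => ENNReal.ofReal_toReal (huTop s)
  let x : I → ℝ := fun i => f i
  have hlap : ∀ i, lap T r w x i = - (killRate r w i * (1 - x i)) := by
    intro i
    have h1 := avg_absorbedQ hT hbranch hpos hmono hf0 i
    rw [hfu, hharm] at h1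
    have hk := killRate_nonneg (r := r) hpos i
    have ht := totalRate_pos hT hbranch hpos hmono i
    have h2 : x i = (killRate r w i * f ⊥ +
        ∑ k ∈ T.neighborFinset i, linkRate T r w i k * f k) /
          (killRate r w i + totalRate T r w i) := by
      have h3 := congrArg ENNReal.toReal h1
      rw [ENNReal.toReal_ofReal] at h3
      · exact h3
      · refine div_nonneg (add_nonneg (mul_nonneg hk (hf0 _)) ?_) (by linarith)
        exact Finset.sum_nonneg fun k _ => mul_nonneg (linkRate_nonneg hpos hmono _ _) (hf0 _)
    rw [eq_div_iff (by linarith)] at h2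
    have h4 : f ⊥ = 1 := by simp only [f, hubot, ENNReal.toReal_one]
    rw [h4] at h2
    rw [lap_eq]
    have h5 : ∑ k ∈ T.neighborFinset i, linkRate T r w i k * x k =
      ∑ k ∈ T.neighborFinset i, linkRate T r w i k * f k := rfl
    rw [h5]
    linarith
  have hlim : ∀ η : Boundary T r, Tendsto x (toBoundary η) (𝓝 0) := by
    intro η
    have h1 : Tendsto (fun i : I => u i) (toBoundary η) (𝓝 0) :=
      tendsto_of_tendsto_of_tendsto_of_le_of_le tendsto_const_nhds (hregular η)
        (fun _ => zero_le) hhit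
    have h2 := (ENNReal.tendsto_toReal ENNReal.zero_ne_top).comp h1
    rw [ENNReal.toReal_zero] at h2
    exact h2
  have hxr : x r < 1 := by
    by_contra hcon
    have hle : x r ≤ 1 := ENNReal.toReal_le_of_le_ofReal zero_le_one (by simpa using hu1 r)
    have h1 : x r = 1 := le_antisymm hle (not_lt.1 hcon)
    -- If `x r = 1`, the source at the root disappears and `x` is harmonic with boundary values `0`,
    -- so it cannot be positive at the root.
    have h2 := nonpos_of_subharmonic hT hbranch hpos hmono (h := x) (fun i _ => ?_)
      (fun η ε hε => ((hlim η).comp (tendsto_toBoundary hT η)).eventually_lt_const hε) r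
    · linarith
    · rw [hlap]
      by_cases hi : i = r
      · rw [hi, h1]; simp
      · simp [killRate, hi]
  have hw : 0 < w 0 := hpos 0
  -- This multiple makes the Laplacian at the root equal to `-1`.
  have hc : 0 < w 0 / (1 - x r) := div_pos hw (by linarith)
  have hvlap : ∀ i, lap T r w (fun k => w 0 / (1 - x r) * x k) i = -if i = r then 1 else 0 := by
    intro i
    rw [lap_const_mul, hlap]
    have : 1 - x r ≠ 0 := by linarith
    by_cases hi : i = r
    · subst hi
      simp only [killRate, if_true]
      field_simp
    · simp [killRate, hi]
  refine ⟨fun i => w 0 / (1 - x r) * x i, ?_, hvlap, fun η => ?_⟩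
  · refine pos_of_lap_eq (r := r) hT hpos hmono (fun i => mul_nonneg hc.le (hf0 _)) ?_ ?_
    · rw [hvlap]; simp
    · intro i hi; rw [hvlap]; simp [hi]
  · simpa using (hlim η).const_mul (w 0 / (1 - x r))

end RootGreen

/-! ### The potential with an arbitrary pole -/

section Green

variable {I : Type*} {T : SimpleGraph I} {r : I} {w : ℕ → ℝ}

variable (T r) in
open Classical in
/-- The indicator function of the subtree below a site. -/
def subInd (k i : I) : ℝ := if Precedes T r k i then 1 else 0

theorem subInd_nonneg (k i : I) : 0 ≤ subInd T r k i := by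
  unfold subInd; split_ifs <;> norm_num

theorem subInd_le_one (k i : I) : subInd T r k i ≤ 1 := by
  unfold subInd; split_ifs <;> norm_num

theorem subInd_of_precedes {k i : I} (h : Precedes T r k i) : subInd T r k i = 1 := if_pos h

theorem subInd_of_not {k i : I} (h : ¬ Precedes T r k i) : subInd T r k i = 0 := if_neg h

theorem not_precedes_parent (hT : T.IsTree) {k : I} (hk : k ≠ r) :
    ¬ Precedes T r k (parent T r k) := by
  rw [precedes_iff hT]
  have := level_parent_add_one hT hk
  omega

theorem not_precedes_root (hT : T.IsTree) {k : I} (hk : k ≠ r) : ¬ Precedes T r k r := by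
  rw [precedes_iff hT, T.dist_self, Nat.le_zero, level_eq_zero hT]
  exact fun h => hk h.1

/-- The indicator of a subtree is eventually constant along each end. -/
theorem eventually_subInd (hT : T.IsTree) (k : I) (η : Boundary T r) :
    (η ∈ endsThrough T r k → ∀ᶠ i in toBoundary η, Precedes T r k i) ∧
      (η ∉ endsThrough T r k → ∀ᶠ i in toBoundary η, ¬ Precedes T r k i) := by
  have hb := toBoundary_hasBasis hT η
  constructor
  · rintro ⟨n, rfl⟩
    exact hb.mem_of_mem (i := n) trivial
  · intro hη
    filter_upwards [hb.mem_of_mem (i := T.dist r k) trivial] with i hi hki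
    have h1 := ((precedes_iff hT).1 hi).2
    rw [η.level, ((precedes_iff hT).1 hki).2] at h1
    exact hη ⟨_, h1.symm⟩

variable [T.LocallyFinite]

open Classical in
-- The cutoff is constant across every edge except the one from `k` to its predecessor. Only the two
-- endpoints of that edge receive a correction, proportional to the value of `f` at the other
-- endpoint.
theorem lap_subInd_mul (hT : T.IsTree) {k : I} (hk : k ≠ r) (f : I → ℝ) (i : I) :
    lap T r w (fun j => subInd T r k j * f j) i = subInd T r k i * lap T r w f i +
      (increment w (T.dist r k))⁻¹ *
        ((if i = parent T r k then f k else 0) - if i = k then f (parent T r k) else 0) := by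
  set p := parent T r k with hp
  set c := (increment w (T.dist r k))⁻¹ with hc
  have hadj : T.Adj k p := adj_parent hT hk
  have hrate : linkRate T r w k p = c := linkRate_parent hT w hk
  have hterm : ∀ m ∈ T.neighborFinset i,
      linkRate T r w i m * (subInd T r k m * f m - subInd T r k i * f i) =
        subInd T r k i * (linkRate T r w i m * (f m - f i)) +
          ((if m = k then (if i = p then c * f k else 0) else 0) -
            if m = p then (if i = k then c * f p else 0) else 0) := by
    intro m hm
    have hm := (T.mem_neighborFinset i m).1 hm
    by_cases h1 : i = k ∧ m = p
    · obtain ⟨rfl, rfl⟩ := h1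
      rw [subInd_of_precedes (precedes_refl i), subInd_of_not (not_precedes_parent hT hk), hrate]
      simp [hadj.ne']
      ring
    by_cases h2 : m = k ∧ i = p
    · obtain ⟨rfl, rfl⟩ := h2
      rw [subInd_of_precedes (precedes_refl m), subInd_of_not (not_precedes_parent hT hk),
        linkRate_comm, hrate]
      simp [hadj.ne]
    have h3 := precedes_iff_of_adj hT hm h1 h2
    have h4 : subInd T r k m = subInd T r k i := by
      unfold subInd; simp only [h3]
    rw [h4]
    have h5 : (if m = k then (if i = p then c * f k else 0) else 0) = 0 := by
      split_ifs with h6 h7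
      · exact absurd ⟨h6, h7⟩ h2
      · rfl
      · rfl
    have h6 : (if m = p then (if i = k then c * f p else 0) else 0) = 0 := by
      split_ifs with h6 h7
      · exact absurd ⟨h7, h6⟩ h1
      · rfl
      · rfl
    rw [h5, h6]
    ring
  rw [lap, Finset.sum_congr rfl hterm, Finset.sum_add_distrib, Finset.sum_sub_distrib,
    ← Finset.mul_sum, ← lap, Finset.sum_ite_eq', Finset.sum_ite_eq', mul_sub]
  congr 2
  · by_cases h : i = p
    · rw [if_pos ((T.mem_neighborFinset i k).2 (h ▸ hadj.symm)), if_pos h, if_pos h]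
    · simp [h]
  · by_cases h : i = k
    · rw [if_pos ((T.mem_neighborFinset i p).2 (h ▸ hadj)), if_pos h, if_pos h]
    · simp [h]

variable (T r w) in
/-- The Green function with pole at `j`, expressed with the Green function `v` with pole at the
root. -/
def green (v : I → ℝ) (j i : I) : ℝ :=
  v j * ((v r)⁻¹ * v i + ∑ n ∈ Finset.range (T.dist r j),
    increment w (n + 1) / (v (anc T r (n + 1) j) * v (anc T r n j)) *
      (subInd T r (anc T r (n + 1) j) i * v i))

theorem lap_sum {ι : Type*} (s : Finset ι) (f : ι → I → ℝ) (i : I) :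
    lap T r w (fun k => ∑ n ∈ s, f n k) i = ∑ n ∈ s, lap T r w (f n) i := by
  simp only [lap, ← Finset.sum_sub_distrib, Finset.mul_sum]
  exact Finset.sum_comm

variable {v : I → ℝ}

open Classical in
-- The weights are chosen so that the `n`-th cutoff contributes a source `1/v` at the ancestor of
-- level `n` and a sink `1/v` at the one of level `n + 1`. The sum telescopes: the source at the
-- root cancels the pole of `v / v(r)`, and the sink at `j`, multiplied by `v j`, is the new pole.
theorem lap_green (hv : IsRootGreen T r w v) (hT : T.IsTree) (hpos : ∀ n, 0 < w n)
    (hmono : StrictMono w) (j i : I) :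
    lap T r w (green T r w v j) i = -if i = j then 1 else 0 := by
  unfold green
  rw [lap_const_mul, lap_add, lap_const_mul, lap_sum, hv.lap_eq]
  have hterm : ∀ n ∈ Finset.range (T.dist r j),
      lap T r w (fun i => increment w (n + 1) / (v (anc T r (n + 1) j) * v (anc T r n j)) *
        (subInd T r (anc T r (n + 1) j) i * v i)) i =
      (if i = anc T r n j then (v i)⁻¹ else 0) - if i = anc T r (n + 1) j then (v i)⁻¹ else 0 := by
    intro n hn
    have hn := Finset.mem_range.1 hn
    have hl : T.dist r (anc T r (n + 1) j) = n + 1 := by rw [level_anc hT]; omega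
    have hne : anc T r (n + 1) j ≠ r := by rw [Ne, ← level_eq_zero hT, hl]; omega
    rw [lap_const_mul, lap_subInd_mul hT hne, hv.lap_eq, hl, parent_anc hn]
    -- The cutoff vanishes at the root and thus removes the pole of `v`.
    have h0 : subInd T r (anc T r (n + 1) j) i * -(if i = r then 1 else 0) = 0 := by
      by_cases hi : i = r
      · rw [hi, subInd_of_not (not_precedes_root hT hne), zero_mul]
      · simp [hi]
    rw [h0, zero_add]
    have h1 := (hv.pos (anc T r (n + 1) j)).ne'
    have h2 := (hv.pos (anc T r n j)).ne'
    have h3 := (increment_pos hpos hmono (n + 1)).ne'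
    have hne' : anc T r n j ≠ anc T r (n + 1) j := by
      intro h
      have := congrArg (T.dist r) h
      rw [level_anc hT, level_anc hT] at this
      omega
    by_cases ha : i = anc T r n j
    · rw [if_pos ha, if_neg (ha ▸ hne'), if_pos ha, if_neg (ha ▸ hne'), ha]
      field_simp
      simp
    · rw [if_neg ha, if_neg ha]
      by_cases hb : i = anc T r (n + 1) j
      · rw [if_pos hb, if_pos hb, hb]
        field_simp
        simp
      · rw [if_neg hb, if_neg hb]
        simp
  rw [Finset.sum_congr rfl hterm,
    Finset.sum_range_sub' (fun n => if i = anc T r n j then (v i)⁻¹ else 0), anc_zero hT,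
    anc_of_level_le le_rfl]
  have h1 := (hv.pos j).ne'
  have h2 := (hv.pos r).ne'
  by_cases hr : i = r
  · by_cases hj : i = j
    · rw [if_pos hr, if_pos hr, if_pos hj, if_pos hj, hj]
      rw [← hr, hj]
      field_simp
      ring
    · rw [if_pos hr, if_pos hr, if_neg hj, if_neg hj, hr]
      field_simp
      ring
  · by_cases hj : i = j
    · rw [if_neg hr, if_neg hr, if_pos hj, if_pos hj, hj]
      field_simp
      ring
    · rw [if_neg hr, if_neg hr, if_neg hj, if_neg hj]
      ring

theorem green_pos (hv : IsRootGreen T r w v) (hpos : ∀ n, 0 < w n) (hmono : StrictMono w) (j i : I)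
    :
    0 < green T r w v j i := by
  refine mul_pos (hv.pos j) (add_pos_of_pos_of_nonneg (mul_pos (inv_pos.2 (hv.pos r)) (hv.pos i))
    (Finset.sum_nonneg fun n _ => ?_))
  exact mul_nonneg (div_nonneg (increment_pos hpos hmono _).le
    (mul_pos (hv.pos _) (hv.pos _)).le) (mul_nonneg (subInd_nonneg _ _) (hv.pos i).le)

/-- The Green function with any pole is dominated by the one with pole at the root. -/
theorem exists_green_le (hv : IsRootGreen T r w v) (hpos : ∀ n, 0 < w n) (hmono : StrictMono w)
    (j : I) :
    ∃ C, 0 ≤ C ∧ ∀ i, green T r w v j i ≤ C * v i := by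
  refine ⟨v j * ((v r)⁻¹ + ∑ n ∈ Finset.range (T.dist r j),
    increment w (n + 1) / (v (anc T r (n + 1) j) * v (anc T r n j))), ?_, fun i => ?_⟩
  · refine mul_nonneg (hv.pos j).le (add_nonneg (inv_pos.2 (hv.pos r)).le
      (Finset.sum_nonneg fun n _ => ?_))
    exact div_nonneg (increment_pos hpos hmono _).le (mul_pos (hv.pos _) (hv.pos _)).le
  · rw [green, mul_assoc, add_mul, Finset.sum_mul]
    refine mul_le_mul_of_nonneg_left (add_le_add le_rfl (Finset.sum_le_sum fun n _ => ?_))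
      (hv.pos j).le
    refine mul_le_mul_of_nonneg_left ?_ (div_nonneg (increment_pos hpos hmono _).le
      (mul_pos (hv.pos _) (hv.pos _)).le)
    exact mul_le_of_le_one_left (hv.pos i).le (subInd_le_one _ _)

theorem tendsto_green (hv : IsRootGreen T r w v) (hpos : ∀ n, 0 < w n) (hmono : StrictMono w)
    (j : I) (η : Boundary T r) :
    Tendsto (green T r w v j) (toBoundary η) (𝓝 0) := by
  obtain ⟨C, -, hC⟩ := exists_green_le hv hpos hmono j
  refine squeeze_zero (fun i => (green_pos hv hpos hmono j i).le) hC ?_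
  simpa using (hv.tendsto η).const_mul C

theorem green_root (hv : IsRootGreen T r w v) (i : I) : green T r w v r i = v i := by
  have := (hv.pos r).ne'
  simp [green, this]

theorem green_apply_root (hv : IsRootGreen T r w v) (hT : T.IsTree) (j : I)
    : green T r w v j r = v j := by
  have h : ∀ n ∈ Finset.range (T.dist r j),
      increment w (n + 1) / (v (anc T r (n + 1) j) * v (anc T r n j)) *
        (subInd T r (anc T r (n + 1) j) r * v r) = 0 := by
    intro n hn
    have hn := Finset.mem_range.1 hn
    rw [subInd_of_not (not_precedes_root hT ?_)]
    · simp
    · rw [Ne, ← level_eq_zero hT, level_anc hT]; omega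
  rw [green, Finset.sum_eq_zero h, inv_mul_cancel₀ (hv.pos r).ne', add_zero, mul_one]

/-- A nonnegative function below the Green function with the same Laplacian is the Green
function. -/
theorem eq_green (hv : IsRootGreen T r w v) (hT : T.IsTree)
    (hbranch : ∀ i, {j | Precedes T r i j}.Infinite)
    (hpos : ∀ n, 0 < w n) (hmono : StrictMono w) {j : I} {f : I → ℝ} (hf0 : ∀ i, 0 ≤ f i)
    (hf : ∀ i, f i ≤ green T r w v j i)
    (hlap : ∀ i, lap T r w f i = lap T r w (green T r w v j) i) (i : I) :
    f i = green T r w v j i := by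
  refine le_antisymm (hf i) ?_
  have := nonpos_of_subharmonic hT hbranch hpos hmono
    (h := fun i => green T r w v j i - f i) (fun i _ => by rw [lap_sub, hlap, sub_self])
    (fun η ε hε => ?_) i
  · linarith
  · filter_upwards [((tendsto_green hv hpos hmono j η).comp
      (tendsto_toBoundary hT η)).eventually_lt_const hε] with n hn
    simp only [Function.comp_apply] at hn
    linarith [hf0 (η n)]

/-- Multiplied by the total rate at `j`, the explicit function solves the first-step equation of the
expected visits, so it bounds these by minimality. The visits are then finite and solve the same
equation, and two such functions, one squeezed between `0` and the other, agree because the larger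
one vanishes at the ends. -/
theorem potential_reflectedQ (hv : IsRootGreen T r w v) [Countable I] [MeasurableSpace I]
    [DiscreteMeasurableSpace I]
    (hT : T.IsTree) (hbranch : ∀ i, {j | Precedes T r i j}.Infinite)
    (hpos : ∀ n, 0 < w n) (hmono : StrictMono w) (i j : I) :
    potential (reflectedQ T r w) i j = ENNReal.ofReal (green T r w v j i) := by
  classical
  set Q := reflectedQ T r w with hQdef
  have hq := totalRate_pos hT hbranch hpos hmono
  have hQ : ∀ i, Q i i < 0 := fun i => by rw [hQdef, reflectedQ_self]; linarith [hq i]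
  have hφ : ∀ s, pointMass j s +
      avg Q (fun s => ENNReal.ofReal (totalRate T r w j * green T r w v j s)) s ≤
        ENNReal.ofReal (totalRate T r w j * green T r w v j s) := by
    intro s
    have h0 : ∀ s, 0 ≤ totalRate T r w j * green T r w v j s := fun s =>
      (mul_pos (hq j) (green_pos hv hpos hmono j s)).le
    rw [avg_reflectedQ hT hbranch hpos hmono h0]
    have h1 := lap_green hv hT hpos hmono j s
    rw [lap_eq] at h1
    have h2 : pointMass j s = ENNReal.ofReal (if s = j then 1 else 0) := by
      by_cases h : s = j
      · simp [h]
      · simp [h, pointMass_of_ne h]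
    have h3 : 0 ≤ (∑ k ∈ T.neighborFinset s, linkRate T r w s k *
        (totalRate T r w j * green T r w v j k)) / totalRate T r w s :=
      div_nonneg (Finset.sum_nonneg fun k _ =>
        mul_nonneg (linkRate_nonneg hpos hmono _ _) (h0 k)) (hq s).le
    rw [h2, ← ENNReal.ofReal_add (by split_ifs <;> norm_num) h3]
    refine ENNReal.ofReal_le_ofReal (le_of_eq ?_)
    have h4 : ∑ k ∈ T.neighborFinset s, linkRate T r w s k *
        (totalRate T r w j * green T r w v j k) = totalRate T r w j *
          ∑ k ∈ T.neighborFinset s, linkRate T r w s k * green T r w v j k := by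
      rw [Finset.mul_sum]
      exact Finset.sum_congr rfl fun k _ => by ring
    rw [h4]
    have h5 := (hq s).ne'
    by_cases h : s = j
    · subst h
      rw [if_pos rfl] at h1 ⊢
      field_simp
      linarith
    · rw [if_neg h] at h1 ⊢
      rw [zero_add, div_eq_iff h5]
      linear_combination totalRate T r w j * h1
  have hle : ∀ s, visits Q s j ≤ ENNReal.ofReal (totalRate T r w j * green T r w v j s) :=
    fun s => visits_le Q j hφ s
  have htop : ∀ s, visits Q s j ≠ ∞ := fun s => ((hle s).trans_lt ENNReal.ofReal_lt_top).ne
  let f : I → ℝ := fun s => (visits Q s j).toReal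
  have hf0 : ∀ s, 0 ≤ f s := fun s => ENNReal.toReal_nonneg
  have hfv : ∀ s, ENNReal.ofReal (f s) = visits Q s j := fun s => ENNReal.ofReal_toReal (htop s)
  have hlapf : ∀ s, lap T r w f s = -if s = j then totalRate T r w j else 0 := by
    intro s
    have h1 := visits_eq Q s j
    simp only [← hfv] at h1
    rw [avg_reflectedQ hT hbranch hpos hmono hf0] at h1
    have h3 : 0 ≤ (∑ k ∈ T.neighborFinset s, linkRate T r w s k * f k) / totalRate T r w s :=
      div_nonneg (Finset.sum_nonneg fun k _ =>
        mul_nonneg (linkRate_nonneg hpos hmono _ _) (hf0 k)) (hq s).le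
    have h5 := (hq s).ne'
    rw [lap_eq]
    by_cases h : s = j
    · subst h
      rw [pointMass_self, ← ENNReal.ofReal_one, ← ENNReal.ofReal_add zero_le_one h3] at h1
      have h2 := congrArg ENNReal.toReal h1
      rw [ENNReal.toReal_ofReal (hf0 _), ENNReal.toReal_ofReal (by positivity)] at h2
      rw [if_pos rfl]
      field_simp at h2
      linarith
    · rw [pointMass_of_ne h, zero_add] at h1
      have h2 := congrArg ENNReal.toReal h1
      rw [ENNReal.toReal_ofReal (hf0 _), ENNReal.toReal_ofReal h3, eq_div_iff h5] at h2
      rw [if_neg h]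
      linarith
  have hqj := (hq j).ne'
  have key := eq_green hv hT hbranch hpos hmono (j := j)
    (f := fun s => (totalRate T r w j)⁻¹ * f s)
    (fun s => mul_nonneg (inv_pos.2 (hq j)).le (hf0 s)) (fun s => ?_) (fun s => ?_) i
  · rw [potential_eq hQ, ← key, hQdef, reflectedQ_self, neg_neg, ← hQdef, ← hfv,
      ← ENNReal.ofReal_div_of_pos (hq j), div_eq_mul_inv, mul_comm]
  · rw [inv_mul_le_iff₀ (hq j)]
    exact ENNReal.toReal_le_of_le_ofReal
      (mul_pos (hq j) (green_pos hv hpos hmono j s)).le (hle s)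
  · rw [lap_const_mul, hlapf, lap_green hv hT hpos hmono]
    by_cases h : s = j
    · simp [h, hqj]
    · simp [h]

end Green

/-! ### Exit points of paths and the exit law of cylinders -/

section ExitLaw

variable {I : Type*} {T : SimpleGraph I} {r : I} {S : Type*} {e : I → S}

variable (T r e) in
/-- The paths which eventually stay in the subtree below a site. -/
def evIn (i : I) : Set (ℕ → S) := {y | ∀ᶠ n in atTop, y n ∈ e '' {k | Precedes T r i k}}

variable (T r e) in
/-- The paths which converge to an end. -/
def exitSet : Set (ℕ → S) := {y | ∃ η : Boundary T r, ∀ n, y ∈ evIn T r e (η n)}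

theorem exitsAt_iff (hT : T.IsTree) {ω : PathSpace S} {η : Boundary T r} :
    ExitsAt T r e ω η ↔ ∀ n, ω.1 ∈ evIn T r e (η n) := by
  unfold ExitsAt
  rw [((toBoundary_hasBasis hT η).map e).tendsto_right_iff]
  simp only [true_imp_iff]
  rfl

/-- At a late common time the path sits at one site below both `i` and `j`, and the ancestors of one
site form a chain. -/
theorem precedes_of_mem_evIn (hT : T.IsTree) (he : Function.Injective e) {y : ℕ → S} {i j : I}
    (hi : y ∈ evIn T r e i) (hj : y ∈ evIn T r e j) (hij : T.dist r i ≤ T.dist r j) :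
    Precedes T r i j := by
  obtain ⟨n, ⟨k, hk, hk'⟩, ⟨l, hl, hl'⟩⟩ := (Filter.Eventually.and hi hj).exists
  have : k = l := he (hk'.trans hl'.symm)
  subst this
  have h1 := (precedes_iff hT).1 hk
  have h2 := (precedes_iff hT).1 hl
  rw [precedes_iff hT]
  refine ⟨hij, ?_⟩
  rw [← h2.2, anc_anc hT hij, h1.2]

theorem eq_of_mem_evIn (hT : T.IsTree) (he : Function.Injective e) {y : ℕ → S} {i j : I}
    (hi : y ∈ evIn T r e i) (hj : y ∈ evIn T r e j) (hij : T.dist r i = T.dist r j) : i = j := by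
  have h := (precedes_iff hT).1 (precedes_of_mem_evIn hT he hi hj hij.le)
  rw [← h.2, anc_of_level_le hij.ge]

theorem mem_endsThrough_iff_evIn (hT : T.IsTree) (he : Function.Injective e) {y : ℕ → S}
    {η : Boundary T r} (hη : ∀ n, y ∈ evIn T r e (η n)) (i : I) :
    η ∈ endsThrough T r i ↔ y ∈ evIn T r e i := by
  constructor
  · rintro ⟨n, rfl⟩
    exact hη n
  · intro h
    exact ⟨T.dist r i, eq_of_mem_evIn hT he (hη _) h (η.level _)⟩

/-- Sites chosen level by level automatically form a geodesic. This replaces the existential over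
all ends by operations indexed by levels and sites, from which measurability follows when `I` is
countable. -/
theorem exitSet_eq (hT : T.IsTree) (he : Function.Injective e) :
    exitSet T r e = ⋂ n : ℕ, ⋃ i ∈ {i : I | T.dist r i = n}, evIn T r e i := by
  ext y
  simp only [Set.mem_iInter, Set.mem_iUnion]
  constructor
  · rintro ⟨η, hη⟩ n
    exact ⟨η n, η.level n, hη n⟩
  · intro h
    choose x hx hx' using h
    refine ⟨⟨x, hx, fun n => ?_⟩, hx'⟩
    have h1 : T.dist r (x n) = n := hx n
    have h2 : T.dist r (x (n + 1)) = n + 1 := hx (n + 1)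
    have h3 := (precedes_iff hT).1
      (precedes_of_mem_evIn hT he (hx' n) (hx' (n + 1)) (by omega))
    refine adj_of_parent_eq (r := r) hT (by rw [Ne, ← level_eq_zero hT]; omega) ?_
    have h4 := parent_anc (T := T) (r := r) (n := n) (i := x (n + 1)) (by omega)
    rw [anc_of_level_le h2.le] at h4
    have h5 := h3.2
    rw [h1] at h5
    rw [h4, h5]

variable [MeasurableSpace S] [DiscreteMeasurableSpace S]

theorem measurableSet_evIn (i : I) : MeasurableSet (evIn T r e i) := by
  have : evIn T r e i = ⋃ N : ℕ, ⋂ n : ℕ, ⋂ _ : N ≤ n,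
      {y : ℕ → S | y n ∈ e '' {k | Precedes T r i k}} := by
    ext y
    simp only [Set.mem_iUnion, Set.mem_iInter]
    exact eventually_atTop
  rw [this]
  refine MeasurableSet.iUnion fun N => MeasurableSet.iInter fun n => MeasurableSet.iInter
      fun _ => ?_
  have h : Measurable fun y : ℕ → S => y n := measurable_pi_apply n
  exact h (MeasurableSet.of_discrete (s := e '' {k | Precedes T r i k}))

variable [Countable I]

theorem measurableSet_exitSet (hT : T.IsTree) (he : Function.Injective e) :
    MeasurableSet (exitSet T r e) := by
  rw [exitSet_eq hT he]
  exact MeasurableSet.iInter fun n => MeasurableSet.biUnion (Set.to_countable _)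
    fun i _ => measurableSet_evIn i

theorem exitEvent_eq (hT : T.IsTree) :
    exitEvent T r e = {ω : PathSpace S | ω.1 ∈ exitSet T r e} := by
  ext ω
  exact exists_congr fun η => exitsAt_iff hT

/-- Whether the chosen limit lies in a cylinder can be read off the path, so the preimages of
cylinders are measurable and depend only on the skeleton. -/
theorem exitLaw_endsThrough (hT : T.IsTree) (he : Function.Injective e) (Q : Matrix S S ℝ) (s : S)
    (i : I) : exitLaw T r e Q s (endsThrough T r i) =
      skeletonLaw Q s (exitSet T r e ∩ evIn T r e i) := by
  have hexit : MeasurableSet (exitEvent T r e : Set (PathSpace S)) := by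
    rw [exitEvent_eq hT]
    exact measurable_fst (measurableSet_exitSet hT he)
  have hpre : ∀ i, (fun ω : exitEvent T r e => ω.2.choose) ⁻¹' endsThrough T r i =
      {ω : exitEvent T r e | ω.1.1 ∈ evIn T r e i} := by
    intro i
    ext ω
    exact mem_endsThrough_iff_evIn hT he ((exitsAt_iff hT).1 ω.2.choose_spec) i
  have hmeas : Measurable fun ω : exitEvent T r e => ω.2.choose := by
    refine measurable_generateFrom ?_
    rintro _ ⟨i, rfl⟩
    rw [hpre]
    exact (measurable_fst.comp measurable_subtype_coe) (measurableSet_evIn i)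
  rw [exitLaw, Measure.map_apply hmeas (measurableSet_endsThrough i),
    comap_subtype_coe_apply hexit, hpre,
    ← pathLaw_skeleton Q s ((measurableSet_exitSet hT he).inter (measurableSet_evIn i))]
  congr 1
  ext ω
  constructor
  · rintro ⟨⟨ω', h⟩, h', rfl⟩
    rw [exitEvent_eq hT] at h
    exact ⟨h, h'⟩
  · rintro ⟨h, hev⟩
    have hω : ω ∈ exitEvent T r e := by rw [exitEvent_eq hT]; exact h
    exact ⟨⟨ω, hω⟩, hev, rfl⟩

/-- The exit law in terms of a bounded harmonic function with boundary values `0` and `1`. -/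
theorem exitLaw_eq_of_harmonic [Countable S] (hT : T.IsTree) (he : Function.Injective e)
    (Q : Matrix S S ℝ) (s : S) (i : I) {g : S → ℝ≥0∞} (hg : ∀ x, avg Q g x = g x)
    (hbdd : ∀ x, g x ≤ 1)
    (hin : ∀ η : Boundary T r, η ∈ endsThrough T r i →
      Tendsto (fun k => g (e k)) (toBoundary η) (𝓝 1))
    (hout : ∀ η : Boundary T r, η ∉ endsThrough T r i →
      Tendsto (fun k => g (e k)) (toBoundary η) (𝓝 0))
    (hae : ∀ᵐ y ∂skeletonLaw Q s, y ∈ exitSet T r e ∨ Tendsto (fun n => g (y n)) atTop (𝓝 0)) :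
    exitLaw T r e Q s (endsThrough T r i) = g s := by
  classical
  have hA := (measurableSet_exitSet (r := r) hT he).inter (measurableSet_evIn (T := T) (r := r)
    (e := e) i)
  rw [exitLaw_endsThrough hT he, ← lintegral_indicator_one hA]
  refine (harmonic_eq_lintegral_lim Q s hg ENNReal.one_ne_top hbdd ?_).symm
  filter_upwards [hae] with y hy
  by_cases hexit : y ∈ exitSet T r e
  · obtain ⟨η, hη⟩ := hexit
    -- Exit at `η` ignores the clocks, so arbitrary ones are supplied.
    have hlim : Tendsto y atTop ((toBoundary η).map e) :=
      (exitsAt_iff (ω := (y, fun _ => 0)) hT).2 hη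
    have hcomp : ∀ {F : Filter ℝ≥0∞}, Tendsto (fun k => g (e k)) (toBoundary η) F →
        Tendsto (fun n => g (y n)) atTop F := by
      intro F hF
      have : Tendsto g ((toBoundary η).map e) F := tendsto_map'_iff.2 hF
      exact this.comp hlim
    by_cases hi : η ∈ endsThrough T r i
    · have : y ∈ exitSet T r e ∩ evIn T r e i :=
        ⟨⟨η, hη⟩, (mem_endsThrough_iff_evIn hT he hη i).1 hi⟩
      rw [Set.indicator_of_mem this]
      exact hcomp (hin η hi)
    · have : y ∉ exitSet T r e ∩ evIn T r e i :=
        fun h => hi ((mem_endsThrough_iff_evIn hT he hη i).2 h.2)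
      rw [Set.indicator_of_notMem this]
      exact hcomp (hout η hi)
  · rw [Set.indicator_of_notMem fun h => hexit h.1]
    exact hy.resolve_left hexit

end ExitLaw

/-! ### Convergence of transient nearest neighbour paths -/

section Transience

variable {I : Type*} {T : SimpleGraph I} [T.LocallyFinite] {r : I}

theorem finite_level_le (hT : T.IsTree) (N : ℕ) : {j | T.dist r j ≤ N}.Finite := by
  induction N with
  | zero =>
    refine (Set.finite_singleton r).subset fun j hj => ?_
    exact (level_eq_zero hT).1 (Nat.le_zero.1 hj)
  | succ N ih =>
    refine (ih.union (ih.biUnion fun k _ => (T.neighborFinset k).finite_toSet)).subset ?_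
    intro j hj
    by_cases hjN : T.dist r j ≤ N
    · exact Or.inl hjN
    · have hjr : j ≠ r := by rintro rfl; simp at hjN
      have hl := level_parent_add_one hT hjr
      have hj' : T.dist r j ≤ N + 1 := hj
      refine Or.inr (Set.mem_biUnion (x := parent T r j) ?_ ?_)
      · show T.dist r (parent T r j) ≤ N
        omega
      · simpa using (adj_parent hT hjr).symm

/-- A nearest neighbour path which visits each site finitely often converges to an end. -/
theorem mem_exitSet_of_finite_visits (hT : T.IsTree) {S : Type*} {e : I → S}
    (he : Function.Injective e) {z : ℕ → I} (hadj : ∀ n, T.Adj (z n) (z (n + 1)))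
    (hfin : ∀ j, ∀ᶠ n in atTop, z n ≠ j) : (fun n => e (z n)) ∈ exitSet T r e := by
  rw [exitSet_eq hT he]
  simp only [Set.mem_iInter, Set.mem_iUnion]
  intro N
  have h1 : ∀ᶠ n in atTop, ∀ j ∈ {j | T.dist r j ≤ N}, z n ≠ j :=
    (eventually_all_finite (finite_level_le hT N)).2 fun j _ => hfin j
  obtain ⟨n₀, hn₀⟩ := eventually_atTop.1 h1
  have h2 : ∀ n ≥ n₀, N ≤ T.dist r (z n) := by
    intro n hn
    by_contra hcon
    exact hn₀ n hn (z n) (by show T.dist r (z n) ≤ N; omega) rfl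
  -- Once the path stays at levels at least `N`, no edge it crosses changes its ancestor at level
  -- `N`.
  have h3 : ∀ n ≥ n₀, anc T r N (z n) = anc T r N (z n₀) := by
    intro n hn
    induction n, hn using Nat.le_induction with
    | base => rfl
    | succ n hn ih =>
      rw [← ih, anc_eq_of_adj hT (hadj n) (h2 n hn) (h2 (n + 1) (by omega))]
  refine ⟨anc T r N (z n₀), ?_, ?_⟩
  · show T.dist r (anc T r N (z n₀)) = N
    rw [level_anc hT]
    exact min_eq_left (h2 n₀ le_rfl)
  · refine eventually_atTop.2 ⟨n₀, fun n hn => ⟨z n, ?_, rfl⟩⟩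
    show Precedes T r _ _
    rw [← h3 n hn]
    exact precedes_anc hT N (z n)

end Transience

/-! ### Exit probabilities of the reflected and the absorbed chain -/

section ExitProb

variable {I : Type*} {T : SimpleGraph I} [T.LocallyFinite] {r : I} {w : ℕ → ℝ}

variable (T r w) in
open Classical in
/-- The probability that the reflected chain from `i` exits below the site `k`. -/
def exitProb (v : I → ℝ) (k i : I) : ℝ :=
  if k = r then 1 else
    (increment w (T.dist r k))⁻¹ * (green T r w v (parent T r k) i - green T r w v k i) +
      subInd T r k i

variable {v : I → ℝ}

/-- The indicator of the subtree has Laplacian `Δ⁻¹` at the predecessor of `k` and `-Δ⁻¹` at `k`;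
the two potentials have poles exactly there, with opposite signs. -/
theorem lap_exitProb (hv : IsRootGreen T r w v) (hT : T.IsTree) (hpos : ∀ n, 0 < w n)
    (hmono : StrictMono w) (k i : I) :
    lap T r w (exitProb T r w v k) i = 0 := by
  classical
  unfold exitProb
  by_cases hk : k = r
  · simp only [if_pos hk]
    exact lap_const w 1 i
  · simp only [if_neg hk]
    have h := lap_subInd_mul (w := w) hT hk (fun _ => 1) i
    simp only [mul_one, lap_const, mul_zero, zero_add] at h
    rw [lap_add, lap_const_mul, lap_sub, lap_green hv hT hpos hmono, lap_green hv hT hpos hmono, h]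
    ring

theorem tendsto_exitProb (hv : IsRootGreen T r w v) (hT : T.IsTree) (hpos : ∀ n, 0 < w n)
    (hmono : StrictMono w) (k : I)
    (η : Boundary T r) :
    (η ∈ endsThrough T r k → Tendsto (exitProb T r w v k) (toBoundary η) (𝓝 1)) ∧
      (η ∉ endsThrough T r k → Tendsto (exitProb T r w v k) (toBoundary η) (𝓝 0)) := by
  by_cases hk : k = r
  · constructor
    · intro _
      have : exitProb T r w v k = fun _ => 1 := funext fun i => by simp [exitProb, hk]
      rw [this]
      exact tendsto_const_nhds
    · intro h
      rw [hk, endsThrough_root hT] at h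
      exact absurd (Set.mem_univ η) h
  · have hdef : exitProb T r w v k = fun i =>
        (increment w (T.dist r k))⁻¹ * (green T r w v (parent T r k) i - green T r w v k i) +
          subInd T r k i := funext fun i => by simp [exitProb, hk]
    have h1 : Tendsto (fun i => (increment w (T.dist r k))⁻¹ *
        (green T r w v (parent T r k) i - green T r w v k i)) (toBoundary η) (𝓝 0) := by
      simpa using ((tendsto_green hv hpos hmono (parent T r k) η).sub
        (tendsto_green hv hpos hmono k η)).const_mul (increment w (T.dist r k))⁻¹
    rw [hdef]
    constructor
    · intro hη
      have h2 : Tendsto (subInd T r k) (toBoundary η) (𝓝 1) :=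
        tendsto_const_nhds.congr' (by
          filter_upwards [(eventually_subInd hT k η).1 hη] with i hi
            using (subInd_of_precedes hi).symm)
      simpa using h1.add h2
    · intro hη
      have h2 : Tendsto (subInd T r k) (toBoundary η) (𝓝 0) :=
        tendsto_const_nhds.congr' (by
          filter_upwards [(eventually_subInd hT k η).2 hη] with i hi
            using (subInd_of_not hi).symm)
      simpa using h1.add h2

theorem exitProb_le_one (hv : IsRootGreen T r w v) (hT : T.IsTree)
    (hbranch : ∀ i, {j | Precedes T r i j}.Infinite)
    (hpos : ∀ n, 0 < w n) (hmono : StrictMono w) (k i : I) : exitProb T r w v k i ≤ 1 := by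
  have := nonpos_of_subharmonic hT hbranch hpos hmono (h := fun i => exitProb T r w v k i - 1)
    (fun i _ => by rw [lap_sub, lap_exitProb hv hT hpos hmono, lap_const, sub_zero])
    (fun η ε hε => ?_) i
  · linarith
  · have ht := tendsto_toBoundary hT η
    by_cases hη : η ∈ endsThrough T r k
    · filter_upwards [(((tendsto_exitProb hv hT hpos hmono k η).1 hη).comp ht).eventually_lt_const
        (show (1 : ℝ) < 1 + ε by linarith)] with n hn
      simp only [Function.comp_apply] at hn
      linarith
    · filter_upwards [(((tendsto_exitProb hv hT hpos hmono k η).2 hη).comp ht).eventually_lt_const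
        (show (0 : ℝ) < 1 + ε by linarith)] with n hn
      simp only [Function.comp_apply] at hn
      linarith

theorem exitProb_nonneg (hv : IsRootGreen T r w v) (hT : T.IsTree)
    (hbranch : ∀ i, {j | Precedes T r i j}.Infinite)
    (hpos : ∀ n, 0 < w n) (hmono : StrictMono w) (k i : I) : 0 ≤ exitProb T r w v k i := by
  have := nonpos_of_subharmonic hT hbranch hpos hmono (h := fun i => - exitProb T r w v k i)
    (fun i _ => by rw [lap_neg, lap_exitProb hv hT hpos hmono, neg_zero])
    (fun η ε hε => ?_) i
  · linarith
  · have ht := tendsto_toBoundary hT η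
    by_cases hη : η ∈ endsThrough T r k
    · filter_upwards [(((tendsto_exitProb hv hT hpos hmono k η).1 hη).comp ht).eventually_const_lt
        (show -ε < (1 : ℝ) by linarith)] with n hn
      simp only [Function.comp_apply] at hn
      linarith
    · filter_upwards [(((tendsto_exitProb hv hT hpos hmono k η).2 hη).comp ht).eventually_const_lt
        (show -ε < (0 : ℝ) by linarith)] with n hn
      simp only [Function.comp_apply] at hn
      linarith

theorem exitProb_apply_root (hv : IsRootGreen T r w v) (hT : T.IsTree) {k : I} (hk : k ≠ r) :
    exitProb T r w v k r = (increment w (T.dist r k))⁻¹ * (v (parent T r k) - v k) := by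
  rw [exitProb, if_neg hk, green_apply_root hv hT, green_apply_root hv hT,
    subInd_of_not (not_precedes_root hT hk), add_zero]

/-- Transience enters here: almost every path started at the root exits, so a bounded harmonic
function is determined by its values at the ends. -/
theorem exitLaw_reflectedQ (hv : IsRootGreen T r w v) [Countable I] [MeasurableSpace I]
    [DiscreteMeasurableSpace I]
    (hT : T.IsTree) (hbranch : ∀ i, {j | Precedes T r i j}.Infinite)
    (hpos : ∀ n, 0 < w n) (hmono : StrictMono w)
    (htransient : pathLaw (reflectedQ T r w) r (exitEvent T r id) = 1) (k : I) :
    exitLaw T r id (reflectedQ T r w) r (endsThrough T r k) =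
      ENNReal.ofReal (exitProb T r w v k r) := by
  refine exitLaw_eq_of_harmonic hT Function.injective_id _ r k
    (g := fun i => ENNReal.ofReal (exitProb T r w v k i)) ?_ ?_ ?_ ?_ ?_
  · intro i
    rw [avg_reflectedQ hT hbranch hpos hmono (exitProb_nonneg hv hT hbranch hpos hmono k)]
    have h := lap_exitProb hv hT hpos hmono k i
    rw [lap_eq, sub_eq_zero] at h
    rw [h, mul_div_cancel_left₀ _ (totalRate_pos hT hbranch hpos hmono i).ne']
  · exact fun i => ENNReal.ofReal_le_one.2 (exitProb_le_one hv hT hbranch hpos hmono k i)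
  · intro η hη
    simpa using ENNReal.tendsto_ofReal ((tendsto_exitProb hv hT hpos hmono k η).1 hη)
  · intro η hη
    simpa using ENNReal.tendsto_ofReal ((tendsto_exitProb hv hT hpos hmono k η).2 hη)
  · have hm := measurableSet_exitSet (T := T) (r := r) hT (Function.injective_id (α := I))
    rw [exitEvent_eq hT, pathLaw_skeleton _ _ hm] at htransient
    filter_upwards [(mem_ae_iff_prob_eq_one hm).2 htransient] with y hy using Or.inl hy

/-- A multiple of the potential of the reflected chain, extended by `0` to `⊥`, is a supersolution
for the absorbed chain, because killing only lowers averages. -/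
theorem visits_absorbedQ_ne_top (hv : IsRootGreen T r w v) [Countable I] (hT : T.IsTree)
    (hbranch : ∀ i, {j | Precedes T r i j}.Infinite)
    (hpos : ∀ n, 0 < w n) (hmono : StrictMono w) (s : WithBot I) (j : I) :
    visits (absorbedQ T r w) s j ≠ ∞ := by
  classical
  have : Countable (WithBot I) := inferInstanceAs (Countable (Option I))
  have hq : ∀ i, 0 < killRate r w i + totalRate T r w i := fun i =>
    add_pos_of_nonneg_of_pos (killRate_nonneg hpos i) (totalRate_pos hT hbranch hpos hmono i)
  have hg := green_pos hv hpos hmono j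
  let f : WithBot I → ℝ := fun s => WithBot.recBotCoe (C := fun _ => ℝ) 0
    (fun i => (killRate r w j + totalRate T r w j) * green T r w v j i) s
  have hfbot : f ⊥ = 0 := rfl
  have hf : ∀ i : I, f i = (killRate r w j + totalRate T r w j) * green T r w v j i :=
    fun i => rfl
  have hf0 : ∀ s, 0 ≤ f s := by
    intro s
    cases s with
    | bot => exact hfbot.ge
    | coe i => rw [hf]; exact (mul_pos (hq j) (hg i)).le
  refine ((visits_le (absorbedQ T r w) (j : WithBot I) (φ := fun s => ENNReal.ofReal (f s))
    (fun s => ?_) s).trans_lt ENNReal.ofReal_lt_top).ne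
  cases s with
  | bot => rw [avg_absorbedQ_bot, pointMass_of_ne WithBot.bot_ne_coe, zero_add]
  | coe i =>
    rw [avg_absorbedQ hT hbranch hpos hmono hf0, hfbot, mul_zero, zero_add]
    have h2 : pointMass (j : WithBot I) i = ENNReal.ofReal (if i = j then 1 else 0) := by
      by_cases h : i = j
      · simp [h]
      · simp [h, pointMass_of_ne (fun h' => h (WithBot.coe_injective h'))]
    have h3 : 0 ≤ (∑ k ∈ T.neighborFinset i, linkRate T r w i k * f k) /
        (killRate r w i + totalRate T r w i) :=
      div_nonneg (Finset.sum_nonneg fun k _ =>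
        mul_nonneg (linkRate_nonneg hpos hmono _ _) (hf0 k)) (hq i).le
    rw [h2, ← ENNReal.ofReal_add (by split_ifs <;> norm_num) h3]
    refine ENNReal.ofReal_le_ofReal ?_
    have h4 : ∑ k ∈ T.neighborFinset i, linkRate T r w i k * f k =
        (killRate r w j + totalRate T r w j) *
          ∑ k ∈ T.neighborFinset i, linkRate T r w i k * green T r w v j k := by
      rw [Finset.mul_sum]
      exact Finset.sum_congr rfl fun k _ => by rw [hf]; ring
    have h1 := lap_green hv hT hpos hmono j i
    rw [lap_eq, sub_eq_iff_eq_add] at h1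
    rw [h4, h1, hf, ← le_sub_iff_add_le', div_le_iff₀ (hq i)]
    have h5 : 0 ≤ (killRate r w j + totalRate T r w j) * (killRate r w i * green T r w v j i) :=
      mul_nonneg (hq j).le (mul_nonneg (killRate_nonneg hpos i) (hg i).le)
    by_cases h : i = j
    · subst h
      rw [if_pos rfl]
      linarith
    · rw [if_neg h]
      linarith

/-- The absorbed chain exits or is absorbed. -/
theorem ae_exit_or_absorbed (hv : IsRootGreen T r w v) [Countable I] (hT : T.IsTree)
    (hbranch : ∀ i, {j | Precedes T r i j}.Infinite)
    (hpos : ∀ n, 0 < w n) (hmono : StrictMono w) (s : WithBot I) :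
    ∀ᵐ y ∂skeletonLaw (absorbedQ T r w) s,
      y ∈ exitSet T r (fun i : I => (i : WithBot I)) ∨ ∀ᶠ n in atTop, y n = ⊥ := by
  have : Countable (WithBot I) := inferInstanceAs (Countable (Option I))
  have hvis : ∀ᵐ y ∂skeletonLaw (absorbedQ T r w) s, ∀ j : I, ∀ᶠ n in atTop,
      y n ≠ (j : WithBot I) :=
    ae_all_iff.2 fun j => ae_finite_visits _ s (j : WithBot I)
      (visits_absorbedQ_ne_top hv hT hbranch hpos hmono s j)
  filter_upwards [ae_skeletonLaw_jump (absorbedQ T r w) s, hvis] with y hjump hy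
  by_cases hbot : ∃ n, y n = ⊥
  · obtain ⟨n₀, hn₀⟩ := hbot
    refine Or.inr (eventually_atTop.2 ⟨n₀, fun n hn => ?_⟩)
    induction n, hn using Nat.le_induction with
    | base => exact hn₀
    | succ n hn ih =>
      have h := hjump n
      rw [ih, jumpPMF_absorbedQ_bot] at h
      by_contra hne
      exact h (by simp [hne])
  · push Not at hbot
    choose z hz using fun n => WithBot.ne_bot_iff_exists.1 (hbot n)
    have hyz : y = fun n => (z n : WithBot I) := funext fun n => (hz n).symm
    left
    rw [hyz]
    refine mem_exitSet_of_finite_visits hT WithBot.coe_injective (fun n => ?_) (fun j => ?_)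
    · refine adj_of_jumpPMF_absorbedQ hT hbranch hpos hmono (r := r) (w := w) ?_
      rw [hz, hz]
      exact hjump n
    · filter_upwards [hy j] with n hn h
      exact hn (by rw [← hz, h])

/-- Subtracting a multiple of `v` from the reflected exit probability keeps the boundary values and
adjusts the Laplacian at the root to the killing there. The resulting factor does not depend on `k`,
so conditioning on exit recovers the reflected exit law. -/
theorem exitLaw_absorbedQ (hv : IsRootGreen T r w v) [Countable I] (hT : T.IsTree)
    (hbranch : ∀ i, {j | Precedes T r i j}.Infinite)
    (hpos : ∀ n, 0 < w n) (hmono : StrictMono w) (k : I) :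
    exitLaw T r (fun i : I => (i : WithBot I)) (absorbedQ T r w) r (endsThrough T r k) =
      ENNReal.ofReal (exitProb T r w v k r * (w 0 / (w 0 + v r))) := by
  classical
  have : Countable (WithBot I) := inferInstanceAs (Countable (Option I))
  have hw := hpos 0
  have hvr := hv.pos r
  have hwv : 0 < w 0 + v r := by linarith
  have hp0 := exitProb_nonneg hv hT hbranch hpos hmono k
  have hp1 := exitProb_le_one hv hT hbranch hpos hmono k
  -- The solution of `c = (exitProb T r w v k r - c * v r) / w 0`, which is the equation at the
  -- root.
  let c := exitProb T r w v k r / (w 0 + v r)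
  have hc : 0 ≤ c := div_nonneg (hp0 r) hwv.le
  let x : I → ℝ := fun i => exitProb T r w v k i - c * v i
  have hxr : x r = exitProb T r w v k r * (w 0 / (w 0 + v r)) := by
    simp only [x, c]
    field_simp
    ring
  have hxr0 : 0 ≤ x r := by
    rw [hxr]
    exact mul_nonneg (hp0 r) (div_pos hw hwv).le
  have hlap : ∀ i, lap T r w x i = killRate r w i * x i := by
    intro i
    simp only [x]
    rw [lap_sub, lap_const_mul, lap_exitProb hv hT hpos hmono, hv.lap_eq, killRate]
    by_cases hi : i = r
    · rw [if_pos hi, if_pos hi, hi]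
      simp only [c]
      field_simp
      ring
    · rw [if_neg hi, if_neg hi]
      ring
  have hxlim : ∀ η : Boundary T r,
      (η ∈ endsThrough T r k → Tendsto x (toBoundary η) (𝓝 1)) ∧
        (η ∉ endsThrough T r k → Tendsto x (toBoundary η) (𝓝 0)) := by
    intro η
    have h1 := (hv.tendsto η).const_mul c
    constructor
    · intro hη
      simpa using ((tendsto_exitProb hv hT hpos hmono k η).1 hη).sub h1
    · intro hη
      simpa using ((tendsto_exitProb hv hT hpos hmono k η).2 hη).sub h1
  have hx0 : ∀ i, 0 ≤ x i := by
    intro i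
    -- As `x r ≥ 0`, the function `-x` is positive only away from the root, where it is harmonic.
    have := nonpos_of_subharmonic hT hbranch hpos hmono (h := fun i => - x i)
      (fun i hi => ?_) (fun η ε hε => ?_) i
    · linarith
    · have hir : i ≠ r := by
        rintro rfl
        linarith
      rw [lap_neg, hlap, killRate, if_neg hir]
      simp
    · have ht := tendsto_toBoundary hT η
      by_cases hη : η ∈ endsThrough T r k
      · filter_upwards [(((hxlim η).1 hη).comp ht).eventually_const_lt
          (show -ε < (1 : ℝ) by linarith)] with n hn
        simp only [Function.comp_apply] at hn
        linarith
      · filter_upwards [(((hxlim η).2 hη).comp ht).eventually_const_lt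
          (show -ε < (0 : ℝ) by linarith)] with n hn
        simp only [Function.comp_apply] at hn
        linarith
  have hx1 : ∀ i, x i ≤ 1 := fun i => by
    have := mul_nonneg hc (hv.pos i).le
    have := hp1 i
    simp only [x]
    linarith
  let f : WithBot I → ℝ := fun s => WithBot.recBotCoe (C := fun _ => ℝ) 0 x s
  have hfbot : f ⊥ = 0 := rfl
  have hf : ∀ i : I, f i = x i := fun i => rfl
  have hf0 : ∀ s, 0 ≤ f s := by
    intro s
    cases s with
    | bot => exact hfbot.ge
    | coe i => exact hx0 i
  rw [← hxr, ← hf]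
  refine exitLaw_eq_of_harmonic hT WithBot.coe_injective _ (r : WithBot I) k
    (g := fun s => ENNReal.ofReal (f s)) ?_ ?_ ?_ ?_ ?_
  · intro s
    cases s with
    | bot => rw [avg_absorbedQ_bot]
    | coe i =>
      rw [avg_absorbedQ hT hbranch hpos hmono hf0, hfbot, mul_zero, zero_add]
      have h := hlap i
      rw [lap_eq, sub_eq_iff_eq_add, ← add_mul] at h
      have hq : 0 < killRate r w i + totalRate T r w i :=
        add_pos_of_nonneg_of_pos (killRate_nonneg hpos i) (totalRate_pos hT hbranch hpos hmono i)
      simp only [hf]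
      rw [h, mul_div_cancel_left₀ _ hq.ne']
  · intro s
    cases s with
    | bot => simp [hfbot]
    | coe i => exact ENNReal.ofReal_le_one.2 (hx1 i)
  · intro η hη
    simp only [hf]
    simpa using ENNReal.tendsto_ofReal ((hxlim η).1 hη)
  · intro η hη
    simp only [hf]
    simpa using ENNReal.tendsto_ofReal ((hxlim η).2 hη)
  · filter_upwards [ae_exit_or_absorbed hv hT hbranch hpos hmono (r : WithBot I)] with y hy
    refine hy.imp id fun h => ?_
    refine tendsto_const_nhds.congr' ?_
    filter_upwards [h] with n hn
    rw [hn, hfbot, ENNReal.ofReal_zero]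

end ExitProb

/-! ### Confluents, and `U` as a sum over cylinders -/

section Meet

variable {I : Type*} {T : SimpleGraph I} {r : I} {w : ℕ → ℝ}

/-- Serves both kinds of confluent; nonemptiness and boundedness exclude the default value of `sSup`
on `ℕ`. -/
theorem le_sSup_iff_of_bounded {P : ℕ → Prop} (h0 : P 0) (hdown : ∀ m n, m ≤ n → P n → P m)
    {B : ℕ} (hB : ∀ n, P n → n ≤ B) (n : ℕ) : n ≤ sSup {n | P n} ↔ P n := by
  have hbdd : BddAbove {n | P n} := ⟨B, fun n hn => hB n hn⟩
  have hmem : P (sSup {n | P n}) := Nat.sSup_mem (s := {n | P n}) ⟨0, h0⟩ hbdd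
  exact ⟨fun h => hdown _ _ h hmem, fun h => le_csSup hbdd h⟩

theorem le_meetLevel_iff (hT : T.IsTree) (i : I) (ξ : Boundary T r) (n : ℕ) :
    n ≤ meetLevel i ξ ↔ Precedes T r (ξ n) i := by
  refine le_sSup_iff_of_bounded (P := fun n => Precedes T r (ξ n) i) ?_ ?_
    (B := T.dist r i) ?_ n
  · rw [ξ.zero hT]; exact root_precedes i
  · exact fun m n h hn => precedes_trans hT (ξ.precedes hT h) hn
  · intro n hn
    have := ((precedes_iff hT).1 hn).1
    rwa [ξ.level] at this

theorem meetLevel_le (hT : T.IsTree) (i : I) (ξ : Boundary T r) : meetLevel i ξ ≤ T.dist r i := by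
  have := ((precedes_iff hT).1 ((le_meetLevel_iff hT i ξ _).1 le_rfl)).1
  rwa [ξ.level] at this

theorem le_meetLevel_iff_anc (hT : T.IsTree) (i : I) (ξ : Boundary T r) (n : ℕ) :
    n ≤ meetLevel i ξ ↔ n ≤ T.dist r i ∧ anc T r n i = ξ n := by
  rw [le_meetLevel_iff hT, precedes_iff hT, ξ.level]

theorem mem_endsThrough_anc (hT : T.IsTree) {i : I} {n : ℕ} (h : n ≤ T.dist r i)
    (ξ : Boundary T r) : ξ ∈ endsThrough T r (anc T r n i) ↔ n ≤ meetLevel i ξ := by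
  rw [mem_endsThrough, level_anc hT, min_eq_left h, le_meetLevel_iff_anc hT]
  exact ⟨fun h' => ⟨h, h'.symm⟩, fun h' => h'.2.symm⟩

/-- Telescoping `w` up to the confluent turns `U` into a finite combination of indicators of
cylinders at the ancestors of `i`, so its integrals reduce to masses of cylinders. -/
theorem siteU_eq_sum (hT : T.IsTree) (i : I) (ξ : Boundary T r) :
    siteU w i ξ = ∑ n ∈ Finset.range (T.dist r i + 1),
      (endsThrough T r (anc T r n i)).indicator (fun _ => increment w n) ξ := by
  classical
  have h1 : ∀ n ∈ Finset.range (T.dist r i + 1),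
      (endsThrough T r (anc T r n i)).indicator (fun _ => increment w n) ξ =
        if n ≤ meetLevel i ξ then increment w n else 0 := by
    intro n hn
    rw [Set.indicator_apply]
    exact if_congr (mem_endsThrough_anc hT (by simpa [Nat.lt_succ_iff] using hn) ξ) rfl rfl
  rw [Finset.sum_congr rfl h1, ← Finset.sum_filter]
  have h2 : (Finset.range (T.dist r i + 1)).filter (fun n => n ≤ meetLevel i ξ) =
      Finset.range (meetLevel i ξ + 1) := by
    ext n
    have := meetLevel_le hT i ξ
    simp only [Finset.mem_filter, Finset.mem_range]
    omega
  rw [h2, sum_increment]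
  rfl

theorem boundaryU_eq_tsum (hT : T.IsTree) (hpos : ∀ n, 0 < w n) (hmono : StrictMono w)
    (η ξ : Boundary T r) :
    boundaryU w η ξ = ∑' n, (ball n η).indicator (fun _ => ENNReal.ofReal (increment w n)) ξ := by
  classical
  have hinc : ∀ n, 0 ≤ increment w n := fun n => (increment_pos hpos hmono n).le
  have hw : ∀ n, ∑ m ∈ Finset.range (n + 1), ENNReal.ofReal (increment w m) =
      ENNReal.ofReal (w n) := by
    intro n
    rw [← ENNReal.ofReal_sum_of_nonneg fun m _ => hinc m, sum_increment]
  unfold boundaryU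
  split_ifs with h
  · subst h
    have h1 : ∀ n, (ball n η).indicator (fun _ => ENNReal.ofReal (increment w n)) η =
        ENNReal.ofReal (increment w n) := fun n => Set.indicator_of_mem (mem_ball.2 rfl) _
    simp only [h1]
    rw [ENNReal.tsum_eq_iSup_nat]
    apply le_antisymm
    · exact iSup_le fun n => le_iSup_of_le (n + 1) (hw n).ge
    · refine iSup_le fun n => le_iSup_of_le n ?_
      rw [← hw n]
      exact Finset.sum_le_sum_of_subset (Finset.range_subset_range.2 n.le_succ)
  · obtain ⟨B, hB⟩ : ∃ B, η B ≠ ξ B := by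
      by_contra! hcon
      exact h (Boundary.ext' hcon)
    have hiff := le_sSup_iff_of_bounded (P := fun n => η n = ξ n)
      (by rw [η.zero hT, ξ.zero hT]) (fun m n hmn hn => Boundary.eq_of_le hT hmn hn) (B := B)
      (fun n hn => by
        by_contra! hlt
        exact hB (Boundary.eq_of_le hT hlt.le hn))
    rw [← hw, tsum_eq_sum (s := Finset.range (sSup {n | η n = ξ n} + 1))]
    · refine Finset.sum_congr rfl fun n hn => ?_
      rw [Set.indicator_of_mem]
      rw [mem_ball, eq_comm]
      exact (hiff n).1 (Nat.lt_succ_iff.1 (Finset.mem_range.1 hn))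
    · intro n hn
      rw [Set.indicator_of_notMem]
      rw [mem_ball, eq_comm]
      intro h'
      exact hn (Finset.mem_range.2 (Nat.lt_succ_iff.2 ((hiff n).2 h')))

end Meet

/-! ### Conditional expectations on balls -/

section Filtration

variable {I : Type*} {T : SimpleGraph I} {r : I}

theorem measurableSet_ball (k : ℕ) (η : Boundary T r) : MeasurableSet (ball k η) :=
  measurableSet_endsThrough _

theorem measurableSet_boundaryFiltration_ball (k : ℕ) (η : Boundary T r) :
    MeasurableSet[boundaryFiltration T r k] (ball k η) :=
  MeasurableSpace.measurableSet_generateFrom ⟨k, le_rfl, η, rfl⟩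

/-- The balls of radius `k` are atoms of the `σ`-field of level `k`. -/
theorem mem_iff_of_measurableSet_boundaryFiltration (hT : T.IsTree) {k : ℕ}
    {A : Set (Boundary T r)} (hA : MeasurableSet[boundaryFiltration T r k] A)
    {ξ η : Boundary T r} (h : ξ k = η k) : ξ ∈ A ↔ η ∈ A := by
  induction A, hA using MeasurableSpace.generateFrom_induction with
  | hC A hA _ =>
    obtain ⟨j, hj, ζ, rfl⟩ := hA
    rw [mem_ball, mem_ball, Boundary.eq_of_le hT hj h]
  | empty => exact Iff.rfl
  | compl A _ ih => exact not_congr ih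
  | iUnion A _ ih =>
    simp only [Set.mem_iUnion]
    exact exists_congr ih

theorem eq_of_stronglyMeasurable_boundaryFiltration (hT : T.IsTree) {k : ℕ}
    {f : Boundary T r → ℝ} (hf : StronglyMeasurable[boundaryFiltration T r k] f)
    {ξ η : Boundary T r} (h : ξ k = η k) : f ξ = f η := by
  have hm := hf.measurable (measurableSet_singleton (f η))
  exact (mem_iff_of_measurableSet_boundaryFiltration hT hm h).2 rfl

theorem measurable_boundaryFiltration_apply [Countable I] (k : ℕ) (f : I → ℝ) :
    Measurable[boundaryFiltration T r k] fun η : Boundary T r => f (η k) := by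
  intro s _
  have : (fun η : Boundary T r => f (η k)) ⁻¹' s =
      ⋃ i ∈ {i : I | T.dist r i = k ∧ f i ∈ s}, endsThrough T r i := by
    ext η
    simp only [Set.mem_iUnion]
    constructor
    · exact fun h => ⟨η k, ⟨η.level k, h⟩, ⟨k, rfl⟩⟩
    · rintro ⟨i, ⟨h1, h2⟩, h3⟩
      rw [mem_endsThrough, h1] at h3
      show f (η k) ∈ s
      rwa [h3]
  rw [this]
  refine @MeasurableSet.biUnion _ _ (boundaryFiltration T r k) _ _ (Set.to_countable _)
    fun i hi => ?_
  have hik : T.dist r i = k := hi.1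
  -- Generators are balls around ends, so a cylinder is recognised as one only if it contains an
  -- end.
  rcases (endsThrough T r i).eq_empty_or_nonempty with h | ⟨ξ, hξ⟩
  · rw [h]; exact @MeasurableSet.empty _ (boundaryFiltration T r k)
  · rw [mem_endsThrough, hik] at hξ
    rw [← hξ]
    exact measurableSet_boundaryFiltration_ball k ξ

/-- The identity holds at every `η`, not just almost everywhere: any strongly measurable version is
constant on the atoms of the `σ`-field. -/
theorem condExp_boundaryFiltration (hT : T.IsTree) {μ : Measure (Boundary T r)}
    [IsFiniteMeasure μ] {f : Boundary T r → ℝ} (hf : Integrable f μ) (k : ℕ) (η : Boundary T r) :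
    (μ[f | boundaryFiltration T r k]) η * μ.real (ball k η) = ∫ ξ in ball k η, f ξ ∂μ := by
  rw [← setIntegral_condExp ((boundaryFiltration T r).le k) hf
    (measurableSet_boundaryFiltration_ball k η)]
  have h : ∀ ξ ∈ ball k η, (μ[f | boundaryFiltration T r k]) ξ =
      (μ[f | boundaryFiltration T r k]) η := fun ξ hξ =>
    eq_of_stronglyMeasurable_boundaryFiltration hT stronglyMeasurable_condExp (mem_ball.1 hξ)
  rw [setIntegral_congr_fun (measurableSet_ball k η) h, setIntegral_const, smul_eq_mul, mul_comm]

variable {w : ℕ → ℝ}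

theorem integrable_siteU (hT : T.IsTree) (i : I) (μ : Measure (Boundary T r)) [IsFiniteMeasure μ] :
    Integrable (siteU w i : Boundary T r → ℝ) μ := by
  rw [show (siteU w i : Boundary T r → ℝ) = fun ξ => _ from funext fun ξ => siteU_eq_sum hT i ξ]
  exact integrable_finsetSum _ fun n _ =>
    (integrable_const _).indicator (measurableSet_endsThrough _)

theorem setIntegral_siteU (hT : T.IsTree) (i : I) (μ : Measure (Boundary T r)) [IsFiniteMeasure μ]
    (A : Set (Boundary T r)) : ∫ ξ in A, siteU w i ξ ∂μ =
      ∑ n ∈ Finset.range (T.dist r i + 1),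
        increment w n * μ.real (endsThrough T r (anc T r n i) ∩ A) := by
  simp only [siteU_eq_sum hT i]
  rw [integral_finsetSum _ fun n _ =>
    (integrable_const _).indicator (measurableSet_endsThrough _)]
  refine Finset.sum_congr rfl fun n _ => ?_
  rw [integral_indicator (measurableSet_endsThrough _), setIntegral_const, smul_eq_mul, mul_comm,
    measureReal_restrict_apply (measurableSet_endsThrough _)]

end Filtration

/-! ### Telescoping along ends, the process `G` and the Martin kernel -/

section Main

variable {I : Type*} {T : SimpleGraph I} [T.LocallyFinite] {r : I} {w : ℕ → ℝ} {v : I → ℝ}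

theorem endsThrough_subset (hT : T.IsTree) {i j : I} (h : Precedes T r i j) :
    endsThrough T r j ⊆ endsThrough T r i := by
  rintro ξ ⟨n, rfl⟩
  have h1 := (precedes_iff hT).1 h
  rw [ξ.level] at h1
  rw [mem_endsThrough, ← ξ.anc hT h1.1, h1.2]

/-- The exit law has mass `(v (k⁻) - v k) / Δ` below a site `k`. -/
structure IsExitLaw (T : SimpleGraph I) (r : I) (w : ℕ → ℝ) (v : I → ℝ)
    (μ : Measure (Boundary T r)) : Prop where
  prob : IsProbabilityMeasure μ
  mul_real_eq : ∀ k, k ≠ r →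
    increment w (T.dist r k) * μ.real (endsThrough T r k) = v (parent T r k) - v k

theorem isExitLaw_reflectedQ [Countable I] [MeasurableSpace I] [DiscreteMeasurableSpace I]
    (hv : IsRootGreen T r w v) (hT : T.IsTree) (hbranch : ∀ i, {j | Precedes T r i j}.Infinite)
    (hpos : ∀ n, 0 < w n) (hmono : StrictMono w)
    (htransient : pathLaw (reflectedQ T r w) r (exitEvent T r id) = 1) :
    IsExitLaw T r w v (exitLaw T r id (reflectedQ T r w) r) := by
  have hμ := exitLaw_reflectedQ hv hT hbranch hpos hmono htransient
  refine ⟨⟨?_⟩, fun k hk => ?_⟩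
  · rw [← endsThrough_root hT, hμ, exitProb, if_pos rfl, ENNReal.ofReal_one]
  · rw [Measure.real, hμ, ENNReal.toReal_ofReal (exitProb_nonneg hv hT hbranch hpos hmono k r),
      exitProb_apply_root hv hT hk, mul_inv_cancel_left₀ (increment_pos hpos hmono _).ne']

theorem increment_add_const (w : ℕ → ℝ) (a : ℝ) {n : ℕ} (hn : n ≠ 0) :
    increment (fun n => w n + a) n = increment w n := by
  cases n with
  | zero => exact absurd rfl hn
  | succ n => simp [increment]

theorem lap_add_const (w : ℕ → ℝ) (a : ℝ) (f : I → ℝ) (i : I) (hT : T.IsTree) :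
    lap T r (fun n => w n + a) f i = lap T r w f i := by
  refine Finset.sum_congr rfl fun k hk => ?_
  have hk := (T.mem_neighborFinset i k).1 hk
  congr 1
  rw [linkRate, linkRate, if_pos hk, if_pos hk, increment_add_const]
  have := hT.dist_ne_of_adj r hk
  omega

namespace IsExitLaw

variable {μ : Measure (Boundary T r)}

theorem mul_real_ball_succ (hμ : IsExitLaw T r w v μ) (hT : T.IsTree) (η : Boundary T r) (n : ℕ) :
    increment w (n + 1) * μ.real (ball (n + 1) η) = v (η n) - v (η (n + 1)) := by
  have h := hμ.mul_real_eq (η (n + 1)) (by rw [Ne, ← level_eq_zero hT, η.level]; omega)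
  rwa [η.level, η.parent_succ hT] at h

theorem real_ball_zero (hμ : IsExitLaw T r w v μ) (hT : T.IsTree) (η : Boundary T r) : μ.real
    (ball 0 η) = 1 := by
  have := hμ.prob
  rw [ball, η.zero hT, endsThrough_root hT, probReal_univ]

/-- A null ball would make `v` constant along `η` from level `k` on, whereas `v` is positive and
tends to `0`. -/
theorem real_ball_pos (hμ : IsExitLaw T r w v μ) (hT : T.IsTree) (hv : IsRootGreen T r w v)
    (η : Boundary T r) (k : ℕ) :
    0 < μ.real (ball k η) := by
  have := hμ.prob
  refine lt_of_le_of_ne measureReal_nonneg fun h0 => ?_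
  have h1 : ∀ n ≥ k, v (η n) = v (η k) := by
    intro n hn
    induction n, hn using Nat.le_induction with
    | base => rfl
    | succ n hn ih =>
      have h2 : μ.real (ball (n + 1) η) = 0 :=
        le_antisymm ((measureReal_mono (endsThrough_subset hT
          (η.precedes hT (by omega : k ≤ n + 1)))).trans h0.ge) measureReal_nonneg
      have h3 := hμ.mul_real_ball_succ hT η n
      rw [h2, mul_zero] at h3
      linarith
  have h2 : Tendsto (fun n => v (η n)) atTop (𝓝 (v (η k))) :=
    tendsto_const_nhds.congr' (by
      filter_upwards [eventually_ge_atTop k] with n hn using (h1 n hn).symm)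
  have h3 := tendsto_nhds_unique h2 ((hv.tendsto η).comp (tendsto_toBoundary hT η))
  exact (hv.pos (η k)).ne' h3

/-- Each term is a decrement of `v` along `η`, and `v` vanishes at the end. This identifies
`G_{k+1}(η)` with `v (η k)`. -/
theorem hasSum (hμ : IsExitLaw T r w v μ) (hT : T.IsTree) (hv : IsRootGreen T r w v)
    (hpos : ∀ n, 0 < w n)
    (hmono : StrictMono w) (η : Boundary T r) (k : ℕ) :
    HasSum (fun n => increment w (k + 1 + n) * μ.real (ball (k + 1 + n) η)) (v (η k)) := by
  rw [hasSum_iff_tendsto_nat_of_nonneg fun n =>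
    mul_nonneg (increment_pos hpos hmono _).le measureReal_nonneg]
  have h1 : ∀ n, ∑ m ∈ Finset.range n, increment w (k + 1 + m) * μ.real (ball (k + 1 + m) η) =
      v (η k) - v (η (k + n)) := by
    intro n
    refine Eq.trans ?_ (Finset.sum_range_sub' (fun m => v (η (k + m))) n)
    refine Finset.sum_congr rfl fun m _ => ?_
    rw [show k + 1 + m = k + m + 1 by omega, hμ.mul_real_ball_succ hT]
    rfl
  simp only [h1]
  have h2 : Tendsto (fun n => v (η (k + n))) atTop (𝓝 0) := by
    have := ((hv.tendsto η).comp (tendsto_toBoundary hT η)).comp (tendsto_add_atTop_nat k)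
    refine this.congr fun n => ?_
    simp [add_comm]
  simpa using h2.const_sub (v (η k))

theorem hasSum_zero (hμ : IsExitLaw T r w v μ) (hT : T.IsTree) (hv : IsRootGreen T r w v)
    (hpos : ∀ n, 0 < w n)
    (hmono : StrictMono w) (η : Boundary T r) :
    HasSum (fun n => increment w n * μ.real (ball n η)) (v r + w 0) := by
  have h := hμ.hasSum hT hv hpos hmono η 0
  rw [η.zero hT] at h
  rw [← hasSum_nat_add_iff' 1]
  simp only [Finset.range_one, Finset.sum_singleton, hμ.real_ball_zero hT, mul_one]
  have h0 : increment w 0 = w 0 := rfl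
  rw [h0, add_sub_cancel_right]
  refine h.congr_fun fun n => ?_
  rw [show 0 + 1 + n = n + 1 by omega]

theorem sum_range (hμ : IsExitLaw T r w v μ) (hT : T.IsTree) (η : Boundary T r) (k : ℕ) :
    ∑ n ∈ Finset.range (k + 1), increment w n * μ.real (ball n η) = v r + w 0 - v (η k) := by
  rw [Finset.sum_range_succ', hμ.real_ball_zero hT, mul_one]
  simp only [hμ.mul_real_ball_succ hT]
  rw [Finset.sum_range_sub' (fun n => v (η n)), η.zero hT]
  simp only [increment]
  ring

theorem lintegral_boundaryU (hμ : IsExitLaw T r w v μ) (hT : T.IsTree) (hv : IsRootGreen T r w v)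
    (hpos : ∀ n, 0 < w n)
    (hmono : StrictMono w) (η : Boundary T r) :
    ∫⁻ ξ, boundaryU w η ξ ∂μ = ENNReal.ofReal (v r + w 0) := by
  have := hμ.prob
  simp only [boundaryU_eq_tsum hT hpos hmono]
  rw [lintegral_tsum fun n =>
    (measurable_const.indicator (measurableSet_ball n η)).aemeasurable]
  have h := hμ.hasSum_zero hT hv hpos hmono η
  rw [← h.tsum_eq, ENNReal.ofReal_tsum_of_nonneg (fun n =>
    mul_nonneg (increment_pos hpos hmono _).le measureReal_nonneg) h.summable]
  refine tsum_congr fun n => ?_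
  rw [lintegral_indicator_const (measurableSet_ball n η),
    ENNReal.ofReal_mul (increment_pos hpos hmono _).le, ofReal_measureReal]

/-- Adding `a` to `w` changes only the increment of index `0`, so the same `v` serves for the
shifted levels, and conditioning cancels the common factor `(w 0 + a) / (w 0 + a + v r)`. The index
`k + 1` keeps the altered increment out of the sum. -/
theorem absorbedG_eq (hμ : IsExitLaw T r w v μ) [Countable I] (hv : IsRootGreen T r w v)
    (hT : T.IsTree)
    (hbranch : ∀ i, {j | Precedes T r i j}.Infinite) (hpos : ∀ n, 0 < w n) (hmono : StrictMono w)
    {a : ℝ} (ha : 0 ≤ a) (k : ℕ) (η : Boundary T r) :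
    absorbedG T r w a (k + 1) η = ENNReal.ofReal (v (η k)) := by
  have := hμ.prob
  have hpos' : ∀ n, 0 < w n + a := fun n => by linarith [hpos n]
  have hmono' : StrictMono fun n => w n + a := fun m n h => by
    have := hmono h
    simp only
    linarith
  have hv' : IsRootGreen T r (fun n => w n + a) v :=
    ⟨hv.pos, fun i => by rw [lap_add_const _ _ _ _ hT, hv.lap_eq], hv.tendsto⟩
  have hlaw := exitLaw_absorbedQ hv' hT hbranch hpos' hmono'
  have hθ : 0 < (w 0 + a) / (w 0 + a + v r) :=
    div_pos (hpos' 0) (add_pos (hpos' 0) (hv.pos r))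
  have hball : ∀ n, absorbedExitLaw T r w a (ball (n + 1) η) =
      ENNReal.ofReal (μ.real (ball (n + 1) η)) := by
    intro n
    have hne : η (n + 1) ≠ r := by rw [Ne, ← level_eq_zero hT, η.level]; omega
    have h1 : exitProb T r (fun n => w n + a) v (η (n + 1)) r = μ.real (ball (n + 1) η) := by
      rw [exitProb_apply_root hv' hT hne, η.level, increment_add_const _ _ (by omega),
        η.parent_succ hT, ← hμ.mul_real_ball_succ hT,
        inv_mul_cancel_left₀ (increment_pos hpos hmono _).ne']
    simp only [absorbedExitLaw]
    rw [Measure.smul_apply, ← endsThrough_root hT, hlaw r, ball, hlaw, h1, exitProb,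
      if_pos rfl, one_mul, smul_eq_mul, ENNReal.ofReal_mul measureReal_nonneg, mul_comm, mul_assoc,
      ENNReal.mul_inv_cancel (by simpa using hθ) ENNReal.ofReal_ne_top, mul_one]
    rfl
  have h := hμ.hasSum hT hv hpos hmono η k
  rw [← h.tsum_eq, ENNReal.ofReal_tsum_of_nonneg (fun n =>
    mul_nonneg (increment_pos hpos hmono _).le measureReal_nonneg) h.summable, absorbedG]
  refine tsum_congr fun n => ?_
  rw [increment_add_const _ _ (by omega), show k + 1 + n = k + n + 1 by omega, hball,
    ENNReal.ofReal_mul (increment_pos hpos hmono _).le]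

/-- Cylinders at the ancestors of `i` up to level `k` contain the ball and contribute `w k` times
its mass; the deeper ones lie inside it, and their weighted masses telescope from `v (η k)` to `v
i`. -/
theorem condExp_siteU (hμ : IsExitLaw T r w v μ) (hT : T.IsTree) (hv : IsRootGreen T r w v) (i : I)
    (η : Boundary T r)
    {k : ℕ} (hk : k ≤ meetLevel i η) :
    (μ[siteU w i | boundaryFiltration T r k]) η = w k + (v (η k) - v i) / μ.real (ball k η) := by
  have := hμ.prob
  have hp := hμ.real_ball_pos hT hv η k
  have hki := (le_meetLevel_iff_anc hT i η k).1 hk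
  have h := condExp_boundaryFiltration (μ := μ) hT (integrable_siteU (w := w) hT i μ) k η
  rw [setIntegral_siteU hT] at h
  obtain ⟨m, hm⟩ : ∃ m, T.dist r i = k + m := ⟨T.dist r i - k, by omega⟩
  have hlev : ∀ n, n ≤ T.dist r i → T.dist r (anc T r n i) = n := fun n hn => by
    rw [level_anc hT]; omega
  rw [hm, show k + m + 1 = (k + 1) + m by omega, Finset.sum_range_add] at h
  have h1 : ∀ n ∈ Finset.range (k + 1),
      increment w n * μ.real (endsThrough T r (anc T r n i) ∩ ball k η) =
        increment w n * μ.real (ball k η) := by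
    intro n hn
    have hn := Finset.mem_range.1 hn
    rw [Set.inter_eq_self_of_subset_right]
    refine endsThrough_subset hT ?_
    rw [precedes_iff hT, η.level, hlev n (by omega), ← hki.2, anc_anc hT (by omega)]
    exact ⟨by omega, rfl⟩
  have h2 : ∀ n ∈ Finset.range m, increment w (k + 1 + n) *
      μ.real (endsThrough T r (anc T r (k + 1 + n) i) ∩ ball k η) =
        v (anc T r (k + n) i) - v (anc T r (k + (n + 1)) i) := by
    intro n hn
    have hn := Finset.mem_range.1 hn
    have hl := hlev (k + 1 + n) (by omega)
    rw [Set.inter_eq_self_of_subset_left]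
    · have h3 := hμ.mul_real_eq (anc T r (k + 1 + n) i)
        (by rw [Ne, ← level_eq_zero hT, hl]; omega)
      rw [hl] at h3
      rw [h3, show k + 1 + n = (k + n) + 1 by omega, parent_anc (by omega)]
      rfl
    · refine endsThrough_subset hT ?_
      rw [precedes_iff hT, η.level, hl, anc_anc hT (by omega), hki.2]
      exact ⟨by omega, rfl⟩
  rw [Finset.sum_congr rfl h1, Finset.sum_congr rfl h2, ← Finset.sum_mul, sum_increment,
    Finset.sum_range_sub' (fun n => v (anc T r (k + n) i)), add_zero, hki.2, ← hm,
    anc_of_level_le le_rfl] at h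
  rw [← mul_left_inj' hp.ne', h, add_mul, div_mul_cancel₀ _ hp.ne']

/-- One level past the confluent, all ends in the ball meet `i` at the same level, so `U` is
constant there. -/
theorem condExp_siteU_succ (hμ : IsExitLaw T r w v μ) (hT : T.IsTree) (hv : IsRootGreen T r w v)
    (i : I)
    (η : Boundary T r) :
    (μ[siteU w i | boundaryFiltration T r (meetLevel i η + 1)]) η = w (meetLevel i η) := by
  have := hμ.prob
  have hp := hμ.real_ball_pos hT hv η (meetLevel i η + 1)
  have h := condExp_boundaryFiltration (μ := μ) hT (integrable_siteU (w := w) hT i μ)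
    (meetLevel i η + 1) η
  have h1 : ∀ ξ ∈ ball (meetLevel i η + 1) η, siteU w i ξ = w (meetLevel i η) := by
    intro ξ hξ
    have hξ := mem_ball.1 hξ
    rw [siteU]
    congr 1
    apply le_antisymm
    · by_contra! hlt
      have h2 := (le_meetLevel_iff hT i ξ (meetLevel i η + 1)).1 hlt
      rw [hξ] at h2
      have := (le_meetLevel_iff hT i η _).2 h2
      omega
    · rw [le_meetLevel_iff hT, Boundary.eq_of_le hT (Nat.le_succ _) hξ]
      exact (le_meetLevel_iff hT i η _).1 le_rfl
  rw [setIntegral_congr_fun (measurableSet_ball _ η) h1, setIntegral_const, smul_eq_mul,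
    mul_comm] at h
  have hne := hp.ne'
  exact mul_left_cancel₀ hne h

/-- Summation by parts of the conditional expectations. -/
theorem one_add_sum_condExp (hμ : IsExitLaw T r w v μ) (hT : T.IsTree) (hv : IsRootGreen T r w v)
    (i : I)
    (η : Boundary T r) :
    1 + ∑ k ∈ Finset.range (meetLevel i η + 1),
      (v (η k))⁻¹ * ((μ[siteU w i | boundaryFiltration T r (k + 1)]) η -
        (μ[siteU w i | boundaryFiltration T r k]) η) =
      (v r)⁻¹ * v i + ∑ n ∈ Finset.range (meetLevel i η),
        increment w (n + 1) / (v (η (n + 1)) * v (η n)) * v i := by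
  -- The last term is the boundary term of the summation by parts. At the confluent it is cancelled
  -- exactly by the final increment, where the conditional expectation returns to `w`.
  have key : ∀ m ≤ meetLevel i η, 1 + ∑ k ∈ Finset.range m,
      (v (η k))⁻¹ * ((μ[siteU w i | boundaryFiltration T r (k + 1)]) η -
        (μ[siteU w i | boundaryFiltration T r k]) η) =
      ((v r)⁻¹ * v i + ∑ n ∈ Finset.range m,
        increment w (n + 1) / (v (η (n + 1)) * v (η n)) * v i) +
        (1 - v i / v (η m)) / μ.real (ball m η) := by
    intro m
    induction m with
    | zero =>
      intro _
      rw [hμ.real_ball_zero hT, η.zero hT]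
      simp [div_eq_mul_inv, mul_comm]
    | succ m ih =>
      intro hm
      rw [Finset.sum_range_succ, Finset.sum_range_succ, ← add_assoc, ih (by omega),
        hμ.condExp_siteU hT hv i η hm, hμ.condExp_siteU hT hv i η (by omega : m ≤ _)]
      have h1 := hμ.mul_real_ball_succ hT η m
      have hp := (hμ.real_ball_pos hT hv η m).ne'
      have hp' := (hμ.real_ball_pos hT hv η (m + 1)).ne'
      have hvm := (hv.pos (η m)).ne'
      have hvm' := (hv.pos (η (m + 1))).ne'
      have h2 : w (m + 1) = w m + increment w (m + 1) := by simp [increment]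
      have h3 : increment w (m + 1) = (v (η m) - v (η (m + 1))) / μ.real (ball (m + 1) η) := by
        rw [eq_div_iff hp', h1]
      rw [h2, h3]
      field_simp
      ring
  rw [Finset.sum_range_succ, ← add_assoc, key _ le_rfl, hμ.condExp_siteU_succ hT hv,
    hμ.condExp_siteU hT hv i η le_rfl]
  have hp := (hμ.real_ball_pos hT hv η (meetLevel i η)).ne'
  have hvm := (hv.pos (η (meetLevel i η))).ne'
  field_simp
  ring

end IsExitLaw

/-- The Martin kernel is attained below the site following the confluent. -/
theorem green_div_green (hT : T.IsTree) (hv : IsRootGreen T r w v) (i : I) (η : Boundary T r)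
    {j : I} (hj : Precedes T r (η (meetLevel i η + 1)) j) :
    green T r w v j i / green T r w v j r = (v r)⁻¹ * v i +
      ∑ n ∈ Finset.range (meetLevel i η),
        increment w (n + 1) / (v (η (n + 1)) * v (η n)) * v i := by
  rw [green_apply_root hv hT, green, mul_div_cancel_left₀ _ (hv.pos j).ne']
  congr 1
  have hj' := (precedes_iff hT).1 hj
  rw [η.level] at hj'
  have hanc : ∀ n ≤ meetLevel i η + 1, anc T r n j = η n := by
    intro n hn
    rw [← η.anc hT hn, ← hj'.2, anc_anc hT hn]
  symm
  -- Past the confluent the ancestors of `j` lie below a site that does not precede `i`, so their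
  -- cutoffs vanish at `i`; before it they are the sites `η n`.
  refine Finset.sum_subset_zero_on_sdiff (Finset.range_subset_range.2 (by omega)) ?_ ?_
  · intro n hn
    have hn1 := Finset.mem_range.1 (Finset.mem_sdiff.1 hn).1
    have hn2 : meetLevel i η ≤ n := by simpa using (Finset.mem_sdiff.1 hn).2
    rw [subInd_of_not]
    · simp
    · intro hp
      have h1 : Precedes T r (η (meetLevel i η + 1)) (anc T r (n + 1) j) := by
        rw [precedes_iff hT, η.level, level_anc hT, anc_anc hT (by omega), hanc _ le_rfl]
        exact ⟨by omega, rfl⟩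
      have := (le_meetLevel_iff hT i η _).2 (precedes_trans hT h1 hp)
      omega
  · intro n hn
    have hn := Finset.mem_range.1 hn
    rw [hanc _ (by omega), hanc _ (by omega),
      subInd_of_precedes ((le_meetLevel_iff hT i η _).1 hn), one_mul]

end Main

end

end TreePotential

open TreePotential
theorem mainTheorem4 {I : Type*} [Countable I] [MeasurableSpace I] [DiscreteMeasurableSpace I]
    (T : SimpleGraph I) [T.LocallyFinite] (hT : T.IsTree) (r : I)
    (hbranch : ∀ i, {j | Precedes T r i j}.Infinite)
    (w : ℕ → ℝ) (hpos : ∀ n, 0 < w n) (hmono : StrictMono w)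
    (htransient : pathLaw (reflectedQ T r w) r (exitEvent T r id) = 1)
    (hregular : ∀ η : Boundary T r, IsRegularPoint T r w η)
    (μ : Measure (Boundary T r)) (hμ : μ = exitLaw T r id (reflectedQ T r w) r)
    (V : I → I → ℝ≥0∞) (hV : V = potential (reflectedQ T r w)) :
    (∀ i j, 0 < V i j ∧ V i j < ∞) ∧
    ∃ G : ℕ → Boundary T r → ℝ,
      (∀ η, ∫⁻ ξ, boundaryU w η ξ ∂μ = ENNReal.ofReal (G 0 η)) ∧
      (∀ k, 1 ≤ k → ∀ η,
        Tendsto (fun a : ℝ => absorbedG T r w a k η) atTop (𝓝 (ENNReal.ofReal (G k η)))) ∧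
      (∀ η, G 0 η = (V r r).toReal + w 0) ∧
      (∀ k η, 0 < G k η) ∧
      (∀ η, StrictAnti fun k => G k η) ∧
      IsStronglyPredictable (boundaryFiltration T r) G ∧
      (∀ k, 1 ≤ k → ∀ η,
        G k η = G 0 η - ∑ n ∈ Finset.range k, increment w n * μ.real (ball n η) ∧
        HasSum (fun n => increment w (k + n) * μ.real (ball (k + n) η)) (G k η)) ∧
      ∀ (i : I) (η : Boundary T r),
        Tendsto (fun j => (V i j).toReal / (V r j).toReal) (toBoundary η)
          (𝓝 (1 + ∑ k ∈ Finset.Icc 1 (meetLevel i η + 1),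
            (G k η)⁻¹ * ((μ[siteU w i | boundaryFiltration T r k]) η -
              (μ[siteU w i | boundaryFiltration T r (k - 1)]) η))) := by
  obtain ⟨v, hv⟩ := exists_isRootGreen hT hbranch hpos hmono hregular
  have hμ' : IsExitLaw T r w v μ := by
    rw [hμ]
    exact isExitLaw_reflectedQ hv hT hbranch hpos hmono htransient
  have hVg : ∀ i j, V i j = ENNReal.ofReal (green T r w v j i) := fun i j => by
    rw [hV, potential_reflectedQ hv hT hbranch hpos hmono]
  have hVr : ∀ i j, (V i j).toReal = green T r w v j i := fun i j => by
    rw [hVg, ENNReal.toReal_ofReal (green_pos hv hpos hmono j i).le]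
  -- The witness is `v` along `η`, delayed by one level; the delay is what makes it predictable.
  refine ⟨fun i j => ?_, fun k η => Nat.casesOn k (v r + w 0) fun m => v (η m),
    fun η => ?_, fun k hk η => ?_, fun η => ?_, fun k η => ?_, fun η => ?_, ?_, fun k hk η => ?_,
    fun i η => ?_⟩
  · rw [hVg]
    exact ⟨ENNReal.ofReal_pos.2 (green_pos hv hpos hmono j i), ENNReal.ofReal_lt_top⟩
  · exact hμ'.lintegral_boundaryU hT hv hpos hmono η
  · obtain ⟨m, rfl⟩ : ∃ m, k = m + 1 := ⟨k - 1, by omega⟩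
    -- The family is constant for `a ≥ 0`, so the limit is trivial.
    refine tendsto_const_nhds.congr' ?_
    filter_upwards [eventually_ge_atTop 0] with a ha
    exact (hμ'.absorbedG_eq hv hT hbranch hpos hmono ha m η).symm
  · show v r + w 0 = _
    rw [hVr, green_root hv]
  · cases k with
    | zero => exact add_pos (hv.pos r) (hpos 0)
    | succ m => exact hv.pos (η m)
  · refine strictAnti_nat_of_succ_lt fun k => ?_
    cases k with
    | zero =>
      show v (η 0) < v r + w 0
      rw [η.zero hT]
      linarith [hpos 0]
    | succ m =>
      show v (η (m + 1)) < v (η m)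
      have h1 := hμ'.mul_real_ball_succ hT η m
      have h2 := mul_pos (increment_pos hpos hmono (m + 1)) (hμ'.real_ball_pos hT hv η (m + 1))
      linarith
  · refine IsStronglyPredictable.of_measurable_add_one stronglyMeasurable_const fun n => ?_
    exact (measurable_boundaryFiltration_apply n v).stronglyMeasurable
  · obtain ⟨m, rfl⟩ : ∃ m, k = m + 1 := ⟨k - 1, by omega⟩
    refine ⟨?_, hμ'.hasSum hT hv hpos hmono η m⟩
    show v (η m) = v r + w 0 - _
    rw [hμ'.sum_range hT]
    ring
  · have hsum : (1 + ∑ k ∈ Finset.Icc 1 (meetLevel i η + 1),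
        (Nat.casesOn k (v r + w 0) fun m => v (η m) : ℝ)⁻¹ *
          ((μ[siteU w i | boundaryFiltration T r k]) η -
            (μ[siteU w i | boundaryFiltration T r (k - 1)]) η)) =
        (v r)⁻¹ * v i + ∑ n ∈ Finset.range (meetLevel i η),
          increment w (n + 1) / (v (η (n + 1)) * v (η n)) * v i := by
      rw [← hμ'.one_add_sum_condExp hT hv i η, ← Finset.Ico_add_one_right_eq_Icc,
        Finset.sum_Ico_eq_sum_range]
      congr 1
      refine Finset.sum_congr (by simp) fun k _ => ?_
      rw [add_comm 1 k]
      rfl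
    rw [hsum]
    -- The quotient is constant on the neighbourhood of `η` below the site after the confluent.
    refine tendsto_const_nhds.congr' ?_
    filter_upwards [(toBoundary_hasBasis hT η).mem_of_mem (i := meetLevel i η + 1) trivial]
      with j hj
    rw [hVr, hVr, green_div_green hT hv i η hj]
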